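/- A fractal string is a bounded open set $\Omega\subset\mathbb{R}$ which is not a finite union of intervals. Let $(I_j)_{j\ge 1}$ be its connected components (disjoint open intervals), $\ell_j=|I_j|$ their lengths, and $|\Omega|=\sum_{j}\ell_j$ its length. Its frequencies are the numbers $n\,\ell_j^{-1}$ ($n\ge 1$, $j\ge 1$), counted with multiplicity, and for $x>0$ $$N_\nu(x):=\#\{(n,j): n\ge 1,\ j\ge 1,\ n\,\ell_j^{-1}\le x\}$$ is its spectral counting function. For $\varepsilon>0$ let $V(\varepsilon)$ be the length (Lebesgue measure) of $\{y\in\Omega : d(y,\partial\Omega)<\varepsilon\}$. For $d\ge 0$, the $d$-dimensional upper and lower Minkowski contents $\mathcal{M}^*_d,\mathcal{M}_{*,d}\in[0,\infty]$ are the $\limsup$ and the $\liminf$ of $V(\varepsilon)/\varepsilon^{1-d}$ as $\varepsilon\to 0^+$, and the Minkowski dimension of the string is $D_\Omega:=\inf\{d\ge 0:\mathcal{M}^*_d<\infty\}$. The string is Minkowski measurable if $0<\mathcal{M}_{*,d}=\mathcal{M}^*_d<\infty$ for $d=D_\Omega$. For $D\in(0,1)$, the inverse spectral problem $(\mathrm{ISP})_D$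 is said to be true if every fractal string of Minkowski dimension $D$ such that $$N_\nu(x)=|\Omega|\,x-\mathcal{C}\,x^D+o(x^D)\qquad\text{as }x\to+\infty$$ for some nonzero real constant $\mathcal{C}$ is Minkowski measurable. **Corollary 6.3.** The inverse spectral problem $(\mathrm{ISP})_D$ is not true in the midfractal case $D=1/2$. -/

import Mathlib

open Filter Topology MeasureTheory Asymptotics
open scoped ENNReal

/-- A (nontrivial) fractal string: a bounded open subset of the real line that is not a finite
union of intervals. (An interval is an order-connected set; open, closed, half-open, degenerate
and unbounded intervals are all included.) -/
structure FractalString where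
  /-- The underlying bounded open set `Ω`. -/
  carrier : Set ℝ
  isOpen_carrier : IsOpen carrier
  isBounded_carrier : Bornology.IsBounded carrier
  not_finite_union : ∀ S : Set (Set ℝ), S.Finite → (∀ I ∈ S, I.OrdConnected) → ⋃₀ S ≠ carrier

noncomputable section

namespace FractalString

/-- The set of the disjoint open intervals `I_j` of which `Ω` is composed, i.e. of its connected
components. -/
def components (L : FractalString) : Set (Set ℝ) :=
  {I | ∃ x ∈ L.carrier, I = connectedComponentIn L.carrier x}

/-- The frequencies of the string, indexed with multiplicity: the pair `(n, I)`, with `n ≥ 1` and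
`I` one of the intervals, carries the frequency `n / |I|`. This is the set of those indices whose
frequency does not exceed `x`. -/
def frequencyIndices (L : FractalString) (x : ℝ) : Set (ℕ × Set ℝ) :=
  {p | 1 ≤ p.1 ∧ p.2 ∈ L.components ∧ (p.1 : ℝ) * (volume.real p.2)⁻¹ ≤ x}

/-- The spectral (frequency) counting function `N_ν(x)`: the number, counted with multiplicity, of
frequencies of the string that do not exceed `x`. The set counted is always finite, since the
intervals are disjoint and their lengths have a finite sum. -/
def spectralCounting (L : FractalString) (x : ℝ) : ℕ :=
  (L.frequencyIndices x).ncard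

/-- The Weyl (leading) term `W(x) = |Ω| x`. -/
def weylTerm (L : FractalString) (x : ℝ) : ℝ :=
  volume.real L.carrier * x

/-- The inner `ε`-neighbourhood `Ω_ε = {x ∈ Ω : d(x, ∂Ω) < ε}` of the boundary. -/
def innerTube (L : FractalString) (ε : ℝ) : Set ℝ :=
  {x ∈ L.carrier | Metric.infDist x (frontier L.carrier) < ε}

/-- The quotient `V(ε) / ε^(1-d)`, where `V(ε)` is the length of the inner `ε`-neighbourhood. -/
def tubeQuotient (L : FractalString) (d ε : ℝ) : ℝ≥0∞ :=
  volume (L.innerTube ε) / ENNReal.ofReal (ε ^ (1 - d))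

/-- The `d`-dimensional upper Minkowski content, a value in `[0, ∞]`. -/
def upperContent (L : FractalString) (d : ℝ) : ℝ≥0∞ :=
  limsup (fun ε : ℝ => L.tubeQuotient d ε) (𝓝[>] 0)

/-- The `d`-dimensional lower Minkowski content, a value in `[0, ∞]`. -/
def lowerContent (L : FractalString) (d : ℝ) : ℝ≥0∞ :=
  liminf (fun ε : ℝ => L.tubeQuotient d ε) (𝓝[>] 0)

/-- The Minkowski dimension: the infimum of all `d ≥ 0` with finite `d`-dimensional upper Minkowski
content. (This set contains `1`, because `Ω` has finite length.) -/
def minkowskiDim (L : FractalString) : ℝ :=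
  sInf {d : ℝ | 0 ≤ d ∧ L.upperContent d < ∞}

/-- Minkowski measurability: in the dimension `D` of the string, the lower and the upper Minkowski
content have a common value, which lies in `(0, ∞)`. -/
def IsMinkowskiMeasurable (L : FractalString) : Prop :=
  0 < L.lowerContent L.minkowskiDim ∧
    L.lowerContent L.minkowskiDim = L.upperContent L.minkowskiDim ∧
    L.upperContent L.minkowskiDim < ∞

/-- The spectral counting function has a monotonic asymptotic second term proportional to `x^D`:
`N_ν(x) = W(x) - C x^D + o(x^D)` as `x → +∞` for some nonzero real constant `C`. -/
def HasMonotonicSecondTerm (L : FractalString) (D : ℝ) : Prop :=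
  ∃ C : ℝ, C ≠ 0 ∧
    (fun x : ℝ => (L.spectralCounting x : ℝ) - (L.weylTerm x - C * x ^ D))
      =o[atTop] (fun x : ℝ => x ^ D)

end FractalString

/-- The inverse spectral problem in dimension `D` has an affirmative answer: every fractal string
of Minkowski dimension `D` whose spectral counting function has a monotonic asymptotic second term
proportional to `x^D` is Minkowski measurable. -/
def InverseSpectralProblem (D : ℝ) : Prop :=
  ∀ L : FractalString, L.minkowskiDim = D → L.HasMonotonicSecondTerm D → L.IsMinkowskiMeasurable

end

/-! Suppose `ρ = 1/2 + iγ` is a zero of zeta with `γ ≠ 0`. Choose lengths `ℓ_j` whose reciprocals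
are counted by the integer part of `M(y) = Re (y^{1/2} + β y^ρ)`, with `β > 0` small enough that `M`
increases. The frequencies up to `x` number `∑_m ⌊M(x/m)⌋`. Apart from the Weyl term, a power `y^s`
in `M` contributes `ζ(s) x^s`, so the oscillating part disappears because `ζ(ρ) = 0`, and `ζ(1/2)
x^{1/2}` with `ζ(1/2) < 0` remains (`isLittleO_oscSpectral`). The tube volume is insensitive to
zeta: with `y = 1/(2ε)`, `√y V(ε)` is asymptotic to `2 + β Re (y^{iγ} / (1 - ρ))`, which stays in a
compact subset of `(0, ∞)` but has no limit (`not_tendsto_oscTube`). Hence the dimension is `1/2`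
and the string is not Minkowski measurable.

The zero comes from a Hardy-type argument (`exists_zero_on_critical_line`). On the critical line the
completed zeta function is real. Its two-sided Laplace transform is expressed through the theta
function (`critLaplace_eq`), and since theta vanishes rapidly at the cusp `-1`, the transform at `x
= π/2 - k` equals `-4π cos (x/4) + O(k³)`. A nonnegative function would have a nonnegative
transform, whereas this one is negative. A nonpositive function would have a concave transform,
whereas `-4π cos (x/4)` is strictly convex there. So the function changes sign. The zero is not at
height `0` because `ζ(1/2) ≤ -1`. -/

/-! ### Regularised partial sums of the zeta series for `Re s > 0`. -/

/-- The difference of consecutive terms of the sequence `∑_{m ≤ n} m^{-s} - n^{1-s}/(1-s)`. -/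
theorem norm_cpow_sub_cpow_slope_le {n : ℕ} (hn : 1 ≤ n) {s : ℂ} (hs : 0 < s.re) (hs1 : s ≠ 1) :
    ‖((n : ℂ) + 1) ^ (-s) - (((n : ℂ) + 1) ^ (1 - s) - (n : ℂ) ^ (1 - s)) / (1 - s)‖ ≤
      ‖s‖ * (n : ℝ) ^ (-(s.re + 1)) := by
  have hn0 : (0 : ℝ) < n := by exact_mod_cast hn
  have h1s : 1 - s ≠ 0 := sub_ne_zero.2 hs1.symm
  have hs0 : s ≠ 0 := by rintro rfl; simp at hs
  set C : ℝ := ‖s‖ * (n : ℝ) ^ (-(s.re + 1)) with hC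
  have hC0 : 0 ≤ C := by positivity
  have key : ∀ x ∈ Set.Icc (n : ℝ) (n + 1),
      ‖((n : ℂ) + 1) ^ (-s) - (x : ℂ) ^ (-s)‖ ≤ C := by
    intro x hx
    have := (convex_Icc (n : ℝ) (n + 1)).norm_image_sub_le_of_norm_hasDerivWithin_le
      (f := fun y : ℝ ↦ (y : ℂ) ^ (-s)) (f' := fun y : ℝ ↦ -s * (y : ℂ) ^ (-s - 1)) (C := C)
      (x := x) (y := (n : ℝ) + 1)
      (fun y hy ↦ (hasDerivAt_ofReal_cpow_const (hn0.trans_le hy.1).ne'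
        (neg_ne_zero.2 hs0)).hasDerivWithinAt)
      (fun y hy ↦ by
        rw [norm_mul, norm_neg, Complex.norm_cpow_eq_rpow_re_of_pos (hn0.trans_le hy.1)]
        refine mul_le_mul_of_nonneg_left ?_ (norm_nonneg _)
        have : (-s - 1).re = -(s.re + 1) := by simp; ring
        rw [this]
        exact Real.rpow_le_rpow_of_nonpos hn0 hy.1 (by linarith)) hx
      (Set.right_mem_Icc.2 (by linarith))
    push_cast at this
    refine this.trans ?_
    refine mul_le_of_le_one_right hC0 ?_
    rw [Real.norm_of_nonneg (by linarith [hx.2])]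
    linarith [hx.1]
  -- The mean value inequality is used a second time, now on the primitive of `(n+1)^{-s} - y^{-s}`;
  -- `key` bounds its derivative.
  have := (convex_Icc (n : ℝ) (n + 1)).norm_image_sub_le_of_norm_hasDerivWithin_le
      (f := fun y : ℝ ↦ (y : ℂ) * ((n : ℂ) + 1) ^ (-s) - (y : ℂ) ^ (1 - s) / (1 - s))
      (f' := fun y : ℝ ↦ ((n : ℂ) + 1) ^ (-s) - (y : ℂ) ^ (-s)) (C := C)
      (x := (n : ℝ)) (y := (n : ℝ) + 1)
      (fun y hy ↦ by
        have h1 := (hasDerivAt_ofReal_cpow_const (hn0.trans_le hy.1).ne' h1s).div_const (1 - s)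
        have h2 := (Complex.ofRealCLM.hasDerivAt (x := y)).mul_const (((n : ℂ) + 1) ^ (-s))
        have h3 := (h2.sub h1).hasDerivWithinAt (s := Set.Icc (n : ℝ) (n + 1))
        refine h3.congr_deriv ?_
        have : (1 - s - 1) = -s := by ring
        rw [this]
        field_simp
        simp)
      key (Set.left_mem_Icc.2 (by linarith)) (Set.right_mem_Icc.2 (by linarith))
  simp only [Complex.ofReal_add, Complex.ofReal_natCast, Complex.ofReal_one, add_sub_cancel_left,
    norm_one, mul_one] at this
  refine le_of_eq_of_le (congrArg norm ?_) this
  ring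

/-- The regularised partial sums `∑_{m ≤ n} m^{-s} - n^{1-s}/(1-s)` of the zeta series. -/
noncomputable def zetaPartial (s : ℂ) (n : ℕ) : ℂ :=
  ∑ m ∈ Finset.range n, ((m : ℂ) + 1) ^ (-s) - (n : ℂ) ^ (1 - s) / (1 - s)

theorem norm_zetaPartial_succ_sub_le {n : ℕ} (hn : 1 ≤ n) {s : ℂ} (hs : 0 < s.re) (hs1 : s ≠ 1) :
    ‖zetaPartial s (n + 1) - zetaPartial s n‖ ≤ ‖s‖ * (n : ℝ) ^ (-(s.re + 1)) := by
  refine le_of_eq_of_le ?_ (norm_cpow_sub_cpow_slope_le hn hs hs1)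
  rw [zetaPartial, zetaPartial, Finset.sum_range_succ]
  push_cast
  congr 1
  ring

/-- For `Re s > 1` this is the Dirichlet series, since `n^{1-s}` tends to `0`. The general case
follows by the identity theorem: the differences are `O(n^{-Re s - 1})`, so the limit is analytic
for `Re s > 0` once the factor `s - 1` has removed the pole; it is compared with the entire function
`riemannZeta₁`. -/
theorem tendsto_zetaPartial {s : ℂ} (hs : 0 < s.re) (hs1 : s ≠ 1) :
    Tendsto (zetaPartial s) atTop (𝓝 (riemannZeta s)) := by
  -- the series of differences, multiplied by `s - 1`, is analytic
  let T : ℕ → ℂ → ℂ := fun k z ↦ (z - 1) * ((k : ℂ) + 1 + 1) ^ (-z) +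
    (((k : ℂ) + 1 + 1) ^ (1 - z) - ((k : ℂ) + 1) ^ (1 - z))
  have hT : ∀ k z, z ≠ 1 → T k z = (z - 1) * (zetaPartial z (k + 1 + 1) - zetaPartial z (k + 1)) := by
    intro k z hz
    have h1 : 1 - z ≠ 0 := sub_ne_zero.2 hz.symm
    rw [zetaPartial, zetaPartial, Finset.sum_range_succ _ (k + 1)]
    simp only [T]
    push_cast
    field_simp
    ring
  have hTb : ∀ k z, 0 < z.re → ‖T k z‖ ≤ ‖z - 1‖ * (‖z‖ * ((k : ℝ) + 1) ^ (-(z.re + 1))) := by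
    intro k z hz
    by_cases hz1 : z = 1
    · subst hz1
      simp [T]
    · rw [hT k z hz1, norm_mul]
      gcongr
      exact_mod_cast norm_zetaPartial_succ_sub_le (Nat.le_add_left 1 k) hz hz1
  have hpart : ∀ z, z ≠ 1 → ∀ n, (z - 1) * zetaPartial z (n + 1) = z + ∑ k ∈ Finset.range n, T k z := by
    intro z hz n
    have h1 : 1 - z ≠ 0 := sub_ne_zero.2 hz.symm
    rw [Finset.sum_congr rfl fun k _ ↦ hT k z hz, ← Finset.mul_sum,
      Finset.sum_range_sub (fun k ↦ zetaPartial z (k + 1))]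
    have : (z - 1) * zetaPartial z (0 + 1) = z := by
      simp [zetaPartial]
      field_simp
      ring
    rw [mul_sub, this]
    ring
  have hsum : ∀ z : ℂ, 0 < z.re → Summable (fun k ↦ T k z) := by
    intro z hz
    refine Summable.of_norm_bounded (((Real.summable_nat_rpow (p := -(z.re + 1))).2
      (by linarith)).comp_injective (add_left_injective 1) |>.mul_left (‖z - 1‖ * ‖z‖)) fun k ↦ ?_
    refine (hTb k z hz).trans_eq ?_
    simp [mul_assoc]
  have hlim : ∀ z : ℂ, 0 < z.re → z ≠ 1 →
      Tendsto (fun n ↦ (z - 1) * zetaPartial z n) atTop (𝓝 (z + ∑' k, T k z)) := by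
    intro z hz hz1
    rw [← tendsto_add_atTop_iff_nat 1]
    simp only [hpart z hz1]
    exact ((hsum z hz).hasSum.tendsto_sum_nat).const_add z
  -- A convex region on which the differences have a uniform summable bound. It contains both `s`
  -- and the point `2 + Re s` of the region of absolute convergence.
  set U : Set ℂ := {z | s.re / 2 < z.re} ∩ Metric.ball 0 (‖s‖ + s.re + 3) with hU
  have hUo : IsOpen U := (isOpen_lt continuous_const Complex.continuous_re).inter Metric.isOpen_ball
  have hUc : Convex ℝ U := (convex_halfSpace_re_gt _).inter (convex_ball _ _)
  have hUpos : ∀ z ∈ U, 0 < z.re := fun z hz ↦ lt_trans (by linarith) hz.1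
  have hdiff : DifferentiableOn ℂ (fun z ↦ z + ∑' k, T k z) U := by
    refine differentiableOn_id.add ?_
    refine Complex.differentiableOn_tsum_of_summable_norm
      (u := fun k : ℕ ↦ (‖s‖ + s.re + 4) * ((‖s‖ + s.re + 3) * ((k : ℝ) + 1) ^ (-(s.re / 2 + 1)))) ?_
      (fun k ↦ ?_) hUo ?_
    · have := ((Real.summable_nat_rpow (p := -(s.re / 2 + 1))).2
        (by linarith)).comp_injective (add_left_injective 1)
      have := (this.mul_left (‖s‖ + s.re + 3)).mul_left (‖s‖ + s.re + 4)
      simpa [Function.comp_def] using this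
    · have h1 : ((k : ℂ) + 1) ≠ 0 := by exact_mod_cast (Nat.succ_ne_zero k)
      have h2 : ((k : ℂ) + 1 + 1) ≠ 0 := by exact_mod_cast (Nat.succ_ne_zero (k + 1))
      intro z _
      refine DifferentiableAt.differentiableWithinAt ?_
      refine DifferentiableAt.add (DifferentiableAt.mul (by fun_prop) ?_) (DifferentiableAt.sub ?_ ?_)
      · exact (differentiableAt_neg_iff.2 differentiableAt_id).const_cpow (Or.inl h2)
      · exact (differentiableAt_id.const_sub 1).const_cpow (Or.inl h2)
      · exact (differentiableAt_id.const_sub 1).const_cpow (Or.inl h1)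
    · intro k z hz
      have hzn : ‖z‖ < ‖s‖ + s.re + 3 := by simpa using hz.2
      refine (hTb k z (hUpos z hz)).trans ?_
      have : ‖z - 1‖ ≤ ‖s‖ + s.re + 4 := (norm_sub_le _ _).trans (by simp; linarith)
      have hz1 := hz.1
      simp only [Set.mem_ofPred_eq] at hz1
      gcongr
      have := norm_nonneg s; linarith
  have h2U : (2 + s.re : ℂ) ∈ U := by
    constructor
    · simp; linarith
    · simp only [Metric.mem_ball, dist_zero_right]
      refine (norm_add_le _ _).trans_lt ?_
      simp [abs_of_pos hs]
      linarith [norm_nonneg s]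
  have hsU : s ∈ U := ⟨by simp; linarith, by simp; linarith⟩
  have hgt : ∀ z : ℂ, 1 < z.re → z + ∑' k, T k z = riemannZeta₁ z := by
    intro z hz
    have hz1 : z ≠ 1 := by rintro rfl; simp at hz
    refine tendsto_nhds_unique (hlim z (by linarith) hz1) ?_
    have h1 : Tendsto (fun n : ℕ ↦ ∑ m ∈ Finset.range n, ((m : ℂ) + 1) ^ (-z)) atTop
        (𝓝 (riemannZeta z)) := by
      rw [zeta_eq_tsum_one_div_nat_add_one_cpow hz]
      have : Summable (fun n : ℕ ↦ 1 / ((n : ℂ) + 1) ^ z) := by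
        have := (Complex.summable_one_div_nat_cpow.2 hz).comp_injective (add_left_injective 1)
        simpa [Function.comp_def] using this
      simpa [Complex.cpow_neg] using this.hasSum.tendsto_sum_nat
    have h2 : Tendsto (fun n : ℕ ↦ (n : ℂ) ^ (1 - z) / (1 - z)) atTop (𝓝 0) := by
      rw [tendsto_zero_iff_norm_tendsto_zero]
      have h3 : Tendsto (fun n : ℕ ↦ (n : ℝ) ^ (-(z.re - 1)) / ‖1 - z‖) atTop (𝓝 (0 / ‖1 - z‖)) :=
        ((tendsto_rpow_neg_atTop (by linarith)).comp tendsto_natCast_atTop_atTop).div_const _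
      rw [zero_div] at h3
      refine h3.congr' ?_
      filter_upwards [eventually_gt_atTop 0] with n hn
      rw [norm_div, Complex.norm_natCast_cpow_of_pos hn]
      simp
    have h4 := (h1.sub h2).const_mul (z - 1)
    rw [sub_zero] at h4
    rwa [riemannZeta_eq_inv_sub_mul hz1, mul_inv_cancel_left₀ (sub_ne_zero.2 hz1)] at h4
  have heq : Set.EqOn (fun z ↦ z + ∑' k, T k z) riemannZeta₁ U := by
    refine (hdiff.analyticOnNhd hUo).eqOn_of_preconnected_of_eventuallyEq
      (differentiable_riemannZeta₁.differentiableOn.analyticOnNhd hUo) hUc.isPreconnected h2U ?_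
    have : {z : ℂ | 1 < z.re} ∈ 𝓝 (2 + s.re : ℂ) :=
      (isOpen_lt continuous_const Complex.continuous_re).mem_nhds (by simp; linarith)
    filter_upwards [this] with z hz using hgt z hz
  have h5 := hlim s hs hs1
  rw [show s + ∑' k, T k s = riemannZeta₁ s from heq hsU] at h5
  have hs' : s - 1 ≠ 0 := sub_ne_zero.2 hs1
  have h6 := h5.const_mul (s - 1)⁻¹
  convert h6 using 2
  · rw [inv_mul_cancel_left₀ hs']
  · exact riemannZeta_eq_inv_sub_mul hs1

/-- Telescoping the partial sums shows that zeta grows at most linearly on a vertical line, which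
the exponential decay of Gamma will absorb. -/
theorem norm_riemannZeta_le {s : ℂ} (hs : 0 < s.re) (hs1 : s ≠ 1) :
    ‖riemannZeta s‖ ≤ ‖1 - 1 / (1 - s)‖ + ‖s‖ * ∑' k : ℕ, ((k : ℝ) + 1) ^ (-(s.re + 1)) := by
  have hsum : Summable (fun k : ℕ ↦ ((k : ℝ) + 1) ^ (-(s.re + 1))) := by
    have := ((Real.summable_nat_rpow (p := -(s.re + 1))).2
      (by linarith)).comp_injective (add_left_injective 1)
    simpa [Function.comp_def] using this
  have h := (tendsto_add_atTop_iff_nat 1).2 (tendsto_zetaPartial hs hs1)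
  refine le_of_tendsto h.norm (Eventually.of_forall fun n ↦ ?_)
  have h1 : zetaPartial s (n + 1) = (1 - 1 / (1 - s)) +
      ∑ k ∈ Finset.range n, (zetaPartial s (k + 1 + 1) - zetaPartial s (k + 1)) := by
    rw [Finset.sum_range_sub (fun k ↦ zetaPartial s (k + 1))]
    simp [zetaPartial]
  rw [h1]
  refine (norm_add_le _ _).trans (add_le_add_right ((norm_sum_le _ _).trans ?_) _)
  refine (Finset.sum_le_sum (g := fun k : ℕ ↦ ‖s‖ * ((k : ℝ) + 1) ^ (-(s.re + 1)))
    fun k _ ↦ ?_).trans ?_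
  · exact_mod_cast norm_zetaPartial_succ_sub_le (Nat.le_add_left 1 k) hs hs1
  · rw [← Finset.mul_sum]
    exact mul_le_mul_of_nonneg_left (hsum.sum_le_tsum _ fun _ _ ↦ by positivity) (norm_nonneg _)

/-- The numbers `∑_{m ≤ n} m^{-1/2} - 2√n` equal `-1` at `n = 1` and decrease, because `1/√b ≤ 2(√b
- √a)` when `b = a + 1`. -/
theorem riemannZeta_half_re_le : (riemannZeta (1 / 2)).re ≤ -1 := by
  have h := (Complex.continuous_re.tendsto _).comp
    ((tendsto_add_atTop_iff_nat 1).2 (tendsto_zetaPartial (s := 1 / 2) (by norm_num) (by norm_num)))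
  have hb : ∀ n : ℕ, (zetaPartial (1 / 2) (n + 1)).re ≤ -1 := by
    have hre : ∀ n : ℕ, (zetaPartial (1 / 2) n).re =
        ∑ m ∈ Finset.range n, (√((m : ℝ) + 1))⁻¹ - 2 * √n := by
      intro n
      have h1 : ∀ m : ℕ, ((m : ℂ) + 1) ^ (-(1 / 2) : ℂ) = (((√((m : ℝ) + 1))⁻¹ : ℝ) : ℂ) := by
        intro m
        rw [Real.sqrt_eq_rpow, ← Real.rpow_neg (by positivity), Complex.ofReal_cpow (by positivity)]
        push_cast
        rfl
      have h2 : (n : ℂ) ^ (1 - 1 / 2 : ℂ) = ((√n : ℝ) : ℂ) := by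
        rw [Real.sqrt_eq_rpow, Complex.ofReal_cpow (by positivity)]
        norm_num
      rw [zetaPartial, h2, Finset.sum_congr rfl fun m _ ↦ h1 m, ← Complex.ofReal_sum,
        show (1 - 1 / 2 : ℂ) = ((1 / 2 : ℝ) : ℂ) by norm_num, ← Complex.ofReal_div,
        ← Complex.ofReal_sub, Complex.ofReal_re]
      ring
    intro n
    induction n with
    | zero => rw [hre]; norm_num
    | succ n ih =>
      rw [hre] at ih ⊢
      rw [Finset.sum_range_succ]
      push_cast at ih ⊢
      have ha : 0 < √((n : ℝ) + 1) := Real.sqrt_pos.2 (by positivity)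
      have hb : 0 < √((n : ℝ) + 1 + 1) := Real.sqrt_pos.2 (by positivity)
      have ha2 := Real.sq_sqrt (show (0 : ℝ) ≤ (n : ℝ) + 1 by positivity)
      have hb2 := Real.sq_sqrt (show (0 : ℝ) ≤ (n : ℝ) + 1 + 1 by positivity)
      have : (√((n : ℝ) + 1 + 1))⁻¹ ≤ 2 * √((n : ℝ) + 1 + 1) - 2 * √((n : ℝ) + 1) := by
        rw [inv_le_iff_one_le_mul₀ hb]
        nlinarith [sq_nonneg (√((n : ℝ) + 1 + 1) - √((n : ℝ) + 1))]
      linarith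
  exact le_of_tendsto h (Eventually.of_forall hb)

theorem riemannZeta_half_ne_zero : riemannZeta (1 / 2) ≠ 0 := fun h0 ↦ by
  have := riemannZeta_half_re_le
  rw [h0] at this
  norm_num at this

/-! ### The Mellin transform of the theta kernel. -/

/-- The theta kernel whose Mellin transform represents the completed zeta function in the
critical strip. -/
noncomputable def thetaKernel (x : ℝ) : ℂ :=
  jacobiTheta (Complex.I * x) - 1 - (x : ℂ) ^ (-(1 / 2) : ℂ)

theorem evenKernel_zero_eq_jacobiTheta (x : ℝ) :
    (HurwitzZeta.evenKernel 0 x : ℂ) = jacobiTheta (Complex.I * x) := by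
  have := HurwitzZeta.evenKernel_def 0 x
  rw [jacobiTheta_eq_jacobiTheta₂]
  simpa using this

/-- `P.f_modif` subtracts `1` only beyond `1` and `x^{-1/2}` only below `1`. Subtracting each on the
other side as well costs `1/s` and `1/(1/2 - s)`, both convergent in this strip, and these are
exactly the polar terms separating `P.Λ₀` from `P.Λ`. -/
theorem hasMellin_thetaKernel {s : ℂ} (hs : 0 < s.re) (hs' : s.re < 1 / 2) :
    HasMellin thetaKernel s (2 * completedRiemannZeta (2 * s)) := by
  set P := HurwitzZeta.hurwitzEvenFEPair 0 with hP
  have h0 : HasMellin P.f_modif s (P.Λ₀ s) :=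
    ⟨(P.isStrongFEPair_toStrongFEPair.hasMellin s).1, rfl⟩
  have h1 := hasMellin_one_Ioc hs
  have hlt : (s - 1 + -(1 / 2)).re < -1 := by norm_num; linarith
  have hne : s - 1 / 2 ≠ 0 := by
    intro h
    have := congrArg Complex.re h
    norm_num at this
    linarith
  have hcongr : ∀ x ∈ Set.Ioi (1 : ℝ), (x : ℂ) ^ (s - 1) • (x : ℂ) ^ (-(1 / 2) : ℂ) =
      (x : ℂ) ^ (s - 1 + -(1 / 2)) := fun x hx ↦ by
    have : (x : ℂ) ≠ 0 := by exact_mod_cast (zero_lt_one.trans hx).ne'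
    rw [smul_eq_mul, Complex.cpow_add _ _ this]
  have hind : ∀ x : ℝ, (x : ℂ) ^ (s - 1) •
      (Set.Ioi (1 : ℝ)).indicator (fun x : ℝ ↦ (x : ℂ) ^ (-(1 / 2) : ℂ)) x =
      (Set.Ioi (1 : ℝ)).indicator (fun x : ℝ ↦ (x : ℂ) ^ (s - 1) • (x : ℂ) ^ (-(1 / 2) : ℂ)) x := by
    intro x
    by_cases hx : x ∈ Set.Ioi (1 : ℝ) <;> simp [hx]
  have hsub : Set.Ioi (0 : ℝ) ∩ Set.Ioi 1 = Set.Ioi 1 := by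
    rw [Set.Ioi_inter_Ioi]; norm_num
  have h2 : HasMellin ((Set.Ioi (1 : ℝ)).indicator (fun x : ℝ ↦ (x : ℂ) ^ (-(1 / 2) : ℂ))) s
      (1 / (1 / 2 - s)) := by
    constructor
    · rw [MellinConvergent]
      simp only [hind]
      rw [integrableOn_indicator_iff measurableSet_Ioi, Set.inter_comm, hsub]
      exact (integrableOn_Ioi_cpow_of_lt hlt one_pos).congr_fun (fun x hx ↦ (hcongr x hx).symm)
        measurableSet_Ioi
    · rw [mellin]
      simp only [hind]
      rw [setIntegral_indicator measurableSet_Ioi, hsub, setIntegral_congr_fun measurableSet_Ioi hcongr,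
        integral_Ioi_cpow_of_lt hlt one_pos]
      have : (1 / 2 - s) ≠ 0 := fun h ↦ hne (by linear_combination -h)
      have e : s - 1 + -(1 / 2) + 1 = s - 1 / 2 := by ring
      rw [e, show s - 1 / 2 = -(1 / 2 - s) by ring, Complex.ofReal_one, Complex.one_cpow,
        neg_div_neg_eq]
  have h3 := hasMellin_sub (hasMellin_sub h0.1 h1.1).1 h2.1
  have h4 : ∀ x ∈ Set.Ioi (0 : ℝ), x ≠ 1 → thetaKernel x = P.f_modif x -
      (Set.Ioc (0 : ℝ) 1).indicator (fun _ ↦ (1 : ℂ)) x -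
      (Set.Ioi (1 : ℝ)).indicator (fun x : ℝ ↦ (x : ℂ) ^ (-(1 / 2) : ℂ)) x := by
    intro x hx hx1
    have hPf : P.f x = jacobiTheta (Complex.I * x) := evenKernel_zero_eq_jacobiTheta x
    have hx0 : (0 : ℝ) < x := hx
    rcases lt_or_gt_of_ne hx1 with h | h
    · have e1 : x ∈ Set.Ioo (0 : ℝ) 1 := ⟨hx, h⟩
      have e2 : x ∈ Set.Ioc (0 : ℝ) 1 := ⟨hx, h.le⟩
      have e3 : x ∉ Set.Ioi (1 : ℝ) := by simpa using h.le
      rw [WeakFEPair.f_modif, Pi.add_apply, Set.indicator_of_notMem e3, Set.indicator_of_mem e1,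
        Set.indicator_of_mem e2, Set.indicator_of_notMem e3, hPf, thetaKernel]
      have : (P.ε * ((x ^ (-P.k) : ℝ) : ℂ)) • P.g₀ = (x : ℂ) ^ (-(1 / 2) : ℂ) := by
        simp only [hP, HurwitzZeta.hurwitzEvenFEPair]
        rw [Complex.ofReal_cpow hx0.le]
        simp
      rw [this]
      ring
    · have e1 : x ∉ Set.Ioo (0 : ℝ) 1 := fun h' ↦ by linarith [h'.2]
      have e2 : x ∉ Set.Ioc (0 : ℝ) 1 := fun h' ↦ by linarith [h'.2]
      have e3 : x ∈ Set.Ioi (1 : ℝ) := h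
      rw [WeakFEPair.f_modif, Pi.add_apply, Set.indicator_of_mem e3, Set.indicator_of_notMem e1,
        Set.indicator_of_notMem e2, Set.indicator_of_mem e3, hPf, thetaKernel]
      have : P.f₀ = 1 := by simp [hP, HurwitzZeta.hurwitzEvenFEPair]
      rw [this]
      ring
  have hae : ∀ᵐ x : ℝ ∂(volume.restrict (Set.Ioi (0 : ℝ))), (x : ℂ) ^ (s - 1) • (P.f_modif x -
      (Set.Ioc (0 : ℝ) 1).indicator (fun _ ↦ (1 : ℂ)) x -
      (Set.Ioi (1 : ℝ)).indicator (fun x : ℝ ↦ (x : ℂ) ^ (-(1 / 2) : ℂ)) x) =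
      (x : ℂ) ^ (s - 1) • thetaKernel x := by
    filter_upwards [ae_restrict_mem measurableSet_Ioi,
      ae_restrict_of_ae (Measure.ae_ne volume 1)] with x hx hx1
    rw [h4 x hx hx1]
  refine ⟨h3.1.congr hae, (integral_congr_ae hae).symm.trans (h3.2.trans ?_)⟩
  rw [(hasMellin_sub h0.1 h1.1).2, h0.2, h1.2, h2.2, completedRiemannZeta,
    HurwitzZeta.completedHurwitzZetaEven, mul_div_cancel_left₀ _ two_ne_zero, ← hP, WeakFEPair.Λ]
  have e1 : P.f₀ = 1 := by simp [hP, HurwitzZeta.hurwitzEvenFEPair]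
  have e2 : P.g₀ = 1 := rfl
  have e3 : P.ε = 1 := rfl
  have e4 : (P.k : ℂ) = 1 / 2 := by simp [hP, HurwitzZeta.hurwitzEvenFEPair]
  rw [e1, e2, e3, e4]
  simp
  ring

/-! ### The completed zeta function on the critical line and the decay of Gamma. -/

/-- The point `1/2 + 2iy` of the critical line. -/
noncomputable def critPoint (y : ℝ) : ℂ := 2 * ((1 / 4 : ℝ) + y * Complex.I)

theorem critPoint_eq (y : ℝ) : critPoint y = 1 / 2 + 2 * y * Complex.I := by
  rw [critPoint]; push_cast; ring

@[simp] theorem critPoint_re (y : ℝ) : (critPoint y).re = 1 / 2 := by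
  simp [critPoint_eq]

theorem critPoint_ne_one (y : ℝ) : critPoint y ≠ 1 := fun h ↦ by
  have := congrArg Complex.re h
  norm_num at this

theorem critPoint_ne_zero (y : ℝ) : critPoint y ≠ 0 := fun h ↦ by
  have := congrArg Complex.re h
  norm_num at this

theorem completedRiemannZeta_eq_Gammaℝ_mul {s : ℂ} (hs : 0 < s.re) :
    completedRiemannZeta s = Complex.Gammaℝ s * riemannZeta s := by
  have h0 : s ≠ 0 := by rintro rfl; simp at hs
  rw [riemannZeta_def_of_ne_zero h0, mul_div_cancel₀ _ (Complex.Gammaℝ_ne_zero_of_re_pos hs)]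

theorem completedRiemannZeta_conj {s : ℂ} (hs : 0 < s.re) :
    completedRiemannZeta ((starRingEnd ℂ) s) = (starRingEnd ℂ) (completedRiemannZeta s) := by
  have h3 : 0 < ((starRingEnd ℂ) s).re := by simpa using hs
  have h4 : (starRingEnd ℂ) s / 2 = (starRingEnd ℂ) (s / 2) := by
    rw [map_div₀, Complex.conj_ofNat]
  have h5 : -(starRingEnd ℂ) s / 2 = (starRingEnd ℂ) (-s / 2) := by
    rw [map_div₀, Complex.conj_ofNat, map_neg]
  have h6 : (Real.pi : ℂ).arg ≠ Real.pi := by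
    rw [Complex.arg_ofReal_of_nonneg Real.pi_pos.le]
    exact Real.pi_pos.ne
  rw [completedRiemannZeta_eq_Gammaℝ_mul h3, completedRiemannZeta_eq_Gammaℝ_mul hs, map_mul,
    riemannZeta_conj, Complex.Gammaℝ_def, Complex.Gammaℝ_def, map_mul, h4, h5, Complex.Gamma_conj,
    Complex.cpow_conj _ _ h6, Complex.conj_ofReal]

/-- On the critical line conjugation is `s ↦ 1 - s`, so the functional equation forces real values.
-/
theorem completedRiemannZeta_critPoint_conj (y : ℝ) :
    (starRingEnd ℂ) (completedRiemannZeta (critPoint y)) = completedRiemannZeta (critPoint y) := by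
  have h1 : (starRingEnd ℂ) (critPoint y) = 1 - critPoint y := by
    rw [critPoint_eq, map_add, map_mul, map_mul, Complex.conj_ofReal, Complex.conj_I, map_div₀,
      Complex.conj_ofNat, map_one]
    ring
  rw [← completedRiemannZeta_conj (by simp), h1, completedRiemannZeta_one_sub]

/-- A substitute for Stirling's formula. The beta integral bounds `|Γ(1/4 + iy)|` by a multiple of
`|Γ(3/4 + iy)|`, and by reflection the product of the two is `π / |sin|`, of size `e^{-π|y|}`; hence
the square root of that bound. -/
theorem norm_Gamma_quarter_le : ∃ C : ℝ, ∀ y : ℝ,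
    ‖Complex.Gamma ((1 / 4 : ℝ) + y * Complex.I)‖ ≤ C * Real.exp (-(Real.pi / 2 * |y|)) := by
  have hre : ∀ y : ℝ, ((1 / 4 : ℝ) + y * Complex.I : ℂ).re = 1 / 4 := fun y ↦ by simp
  set B : ℝ := ∫ x in (0 : ℝ)..1, x ^ (1 / 4 - 1 : ℝ) * (1 - x) ^ (1 / 2 - 1 : ℝ) with hB
  have hbeta : ∀ y : ℝ, ‖Complex.betaIntegral ((1 / 4 : ℝ) + y * Complex.I) (1 / 2)‖ ≤ B := by
    intro y
    rw [Complex.betaIntegral]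
    refine (intervalIntegral.norm_integral_le_integral_norm zero_le_one).trans_eq ?_
    rw [hB, intervalIntegral.integral_of_le zero_le_one, intervalIntegral.integral_of_le zero_le_one,
      integral_Ioc_eq_integral_Ioo, integral_Ioc_eq_integral_Ioo]
    refine setIntegral_congr_fun measurableSet_Ioo fun x hx ↦ ?_
    have h1 : (0 : ℝ) < 1 - x := by linarith [hx.2]
    simp only [norm_mul]
    rw [Complex.norm_cpow_eq_rpow_re_of_pos hx.1,
      show (1 - (x : ℂ)) = ((1 - x : ℝ) : ℂ) by push_cast; rfl,
      Complex.norm_cpow_eq_rpow_re_of_pos h1]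
    norm_num
  have hB0 : 0 ≤ B := (norm_nonneg _).trans (hbeta 0)
  have hle : ∀ y : ℝ, ‖Complex.Gamma ((1 / 4 : ℝ) + y * Complex.I)‖ ≤
      B / √Real.pi * ‖Complex.Gamma ((3 / 4 : ℝ) + y * Complex.I)‖ := by
    intro y
    have h := Complex.Gamma_mul_Gamma_eq_betaIntegral (s := (1 / 4 : ℝ) + y * Complex.I) (t := 1 / 2)
      (by rw [hre]; norm_num) (by norm_num)
    have e : ((1 / 4 : ℝ) + y * Complex.I + 1 / 2 : ℂ) = (3 / 4 : ℝ) + y * Complex.I := by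
      push_cast; ring
    rw [e] at h
    have h2 := congrArg norm h
    rw [norm_mul, norm_mul, Complex.Gamma_one_half_eq] at h2
    have hpi : ‖(Real.pi : ℂ) ^ (1 / 2 : ℂ)‖ = √Real.pi := by
      rw [Complex.norm_cpow_eq_rpow_re_of_pos Real.pi_pos, Real.sqrt_eq_rpow]
      norm_num
    rw [hpi] at h2
    have hp : 0 < √Real.pi := Real.sqrt_pos.2 Real.pi_pos
    rw [div_mul_eq_mul_div, le_div_iff₀ hp, h2, mul_comm]
    exact mul_le_mul_of_nonneg_right (hbeta y) (norm_nonneg _)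
  have hsin : ∀ y : ℝ, Real.exp (Real.pi * |y|) / 2 ≤
      ‖Complex.sin (Real.pi * ((1 / 4 : ℝ) + y * Complex.I))‖ := by
    intro y
    have e : (Real.pi * ((1 / 4 : ℝ) + y * Complex.I) : ℂ) =
        ((Real.pi / 4 : ℝ) : ℂ) + ((Real.pi * y : ℝ) : ℂ) * Complex.I := by push_cast; ring
    rw [e, Complex.sin_add_mul_I, ← Complex.ofReal_sin, ← Complex.ofReal_cos, ← Complex.ofReal_cosh,
      ← Complex.ofReal_sinh, ← Complex.ofReal_mul, ← Complex.ofReal_mul, Complex.norm_add_mul_I,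
      Real.sin_pi_div_four, Real.cos_pi_div_four]
    apply Real.le_sqrt_of_sq_le
    have hc : Real.cosh (Real.pi * y) =
        (Real.exp (Real.pi * |y|) + Real.exp (-(Real.pi * |y|))) / 2 := by
      rw [← Real.cosh_abs, abs_mul, abs_of_pos Real.pi_pos, Real.cosh_eq]
    have he : Real.exp (Real.pi * |y|) * Real.exp (-(Real.pi * |y|)) = 1 := by
      rw [← Real.exp_add, add_neg_cancel, Real.exp_zero]
    have h2 : √2 ^ 2 = (2 : ℝ) := Real.sq_sqrt (by norm_num)
    have h3 := Real.cosh_sq (Real.pi * y)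
    have h4 : (√2 / 2 * Real.cosh (Real.pi * y)) ^ 2 + (√2 / 2 * Real.sinh (Real.pi * y)) ^ 2 =
        Real.cosh (Real.pi * y) ^ 2 - 1 / 2 := by
      rw [mul_pow, mul_pow, div_pow, h2]
      linarith
    rw [h4, hc]
    nlinarith [sq_nonneg (Real.exp (-(Real.pi * |y|)))]
  refine ⟨√(B / √Real.pi * (2 * Real.pi)), fun y ↦ ?_⟩
  have hrefl := congrArg norm (Complex.Gamma_mul_Gamma_one_sub ((1 / 4 : ℝ) + y * Complex.I))
  have hconj : (1 - ((1 / 4 : ℝ) + y * Complex.I) : ℂ) =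
      (starRingEnd ℂ) ((3 / 4 : ℝ) + y * Complex.I) := by
    rw [map_add, map_mul, Complex.conj_ofReal, Complex.conj_ofReal, Complex.conj_I]
    push_cast
    ring
  rw [hconj, Complex.Gamma_conj, norm_mul, RCLike.norm_conj, norm_div, Complex.norm_real,
    Real.norm_of_nonneg Real.pi_pos.le] at hrefl
  have hexp : Real.exp (-(Real.pi / 2 * |y|)) = √(Real.exp (-(Real.pi * |y|))) := by
    rw [← Real.exp_half]; congr 1; ring
  rw [hexp, ← Real.sqrt_mul (by positivity)]
  apply Real.le_sqrt_of_sq_le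
  have h5 : Real.pi / ‖Complex.sin (Real.pi * ((1 / 4 : ℝ) + y * Complex.I))‖ ≤
      2 * Real.pi * Real.exp (-(Real.pi * |y|)) := by
    rw [Real.exp_neg]
    calc _ ≤ Real.pi / (Real.exp (Real.pi * |y|) / 2) := by
          gcongr
          exact hsin y
      _ = _ := by field_simp
  calc _ = ‖Complex.Gamma ((1 / 4 : ℝ) + y * Complex.I)‖ * ‖Complex.Gamma ((1 / 4 : ℝ) + y * Complex.I)‖ := sq _
    _ ≤ ‖Complex.Gamma ((1 / 4 : ℝ) + y * Complex.I)‖ *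
        (B / √Real.pi * ‖Complex.Gamma ((3 / 4 : ℝ) + y * Complex.I)‖) := by
          gcongr; exact hle y
    _ = B / √Real.pi * (Real.pi / ‖Complex.sin (Real.pi * ((1 / 4 : ℝ) + y * Complex.I))‖) := by
          rw [← hrefl]; ring
    _ ≤ B / √Real.pi * (2 * Real.pi * Real.exp (-(Real.pi * |y|))) := by gcongr
    _ = _ := by ring

/-! ### The theta function near the cusp `-1`. -/

theorem jacobiTheta_add_one_add_self {τ : ℂ} (hτ : 0 < τ.im) :
    jacobiTheta (τ + 1) + jacobiTheta τ = 2 * jacobiTheta (4 * τ) := by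
  have h1 : 0 < (τ + 1).im := by simpa using hτ
  have h4 : 0 < (4 * τ).im := by simpa using hτ
  have hs := (hasSum_nat_jacobiTheta h1).add (hasSum_nat_jacobiTheta hτ)
  -- The series runs over `(n + 1)²`, so even indices carry odd squares. The shift `τ + 1`
  -- multiplies the `m²` term by `(-1)^m`, and these terms cancel.
  have hodd : ∀ k : ℕ, Complex.exp (Real.pi * Complex.I * (((2 * k : ℕ) : ℂ) + 1) ^ 2 * (τ + 1)) +
      Complex.exp (Real.pi * Complex.I * (((2 * k : ℕ) : ℂ) + 1) ^ 2 * τ) = 0 := by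
    intro k
    have e : (Real.pi * Complex.I * (((2 * k : ℕ) : ℂ) + 1) ^ 2 * (τ + 1) : ℂ) =
        Real.pi * Complex.I * (((2 * k : ℕ) : ℂ) + 1) ^ 2 * τ +
          (((2 * k ^ 2 + 2 * k : ℕ) : ℂ) * (2 * Real.pi * Complex.I) + Real.pi * Complex.I) := by
      push_cast; ring
    rw [e, Complex.exp_add, Complex.exp_add, Complex.exp_nat_mul_two_pi_mul_I, Complex.exp_pi_mul_I]
    ring
  have heven : ∀ k : ℕ,
      Complex.exp (Real.pi * Complex.I * (((2 * k + 1 : ℕ) : ℂ) + 1) ^ 2 * (τ + 1)) +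
      Complex.exp (Real.pi * Complex.I * (((2 * k + 1 : ℕ) : ℂ) + 1) ^ 2 * τ) =
        2 * Complex.exp (Real.pi * Complex.I * ((k : ℂ) + 1) ^ 2 * (4 * τ)) := by
    intro k
    have e : (Real.pi * Complex.I * (((2 * k + 1 : ℕ) : ℂ) + 1) ^ 2 * (τ + 1) : ℂ) =
        Real.pi * Complex.I * ((k : ℂ) + 1) ^ 2 * (4 * τ) +
          (((2 * (k + 1) ^ 2 : ℕ) : ℂ) * (2 * Real.pi * Complex.I)) := by
      push_cast; ring
    have e' : (Real.pi * Complex.I * (((2 * k + 1 : ℕ) : ℂ) + 1) ^ 2 * τ : ℂ) =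
        Real.pi * Complex.I * ((k : ℂ) + 1) ^ 2 * (4 * τ) := by
      push_cast; ring
    rw [e, e', Complex.exp_add, Complex.exp_nat_mul_two_pi_mul_I]
    ring
  have hs' := HasSum.even_add_odd (f := fun n : ℕ ↦
      Complex.exp (Real.pi * Complex.I * ((n : ℂ) + 1) ^ 2 * (τ + 1)) +
      Complex.exp (Real.pi * Complex.I * ((n : ℂ) + 1) ^ 2 * τ)) (m := 0)
    (m' := 2 * ((jacobiTheta (4 * τ) - 1) / 2))
    (by simp only [hodd]; exact hasSum_zero)
    (by simp only [heven]; exact (hasSum_nat_jacobiTheta h4).mul_left 2)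
  have := hs.unique hs'
  linear_combination 2 * this

theorem jacobiTheta_eq_inv_sqrt_mul (τ : ℂ) :
    jacobiTheta τ = 1 / (-Complex.I * τ) ^ (1 / 2 : ℂ) * jacobiTheta (-1 / τ) := by
  rw [jacobiTheta_eq_jacobiTheta₂, jacobiTheta_eq_jacobiTheta₂, jacobiTheta₂_functional_equation 0 τ]
  simp

/-- Period `2`, the duplication identity, and inversion at `δ` and `4δ`. The constant terms of the
two theta values on the right cancel, which is the source of the decay at the cusp. -/
theorem jacobiTheta_sub_one {δ : ℂ} (hδ : 0 < δ.im) :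
    jacobiTheta (δ - 1) = 1 / (-Complex.I * δ) ^ (1 / 2 : ℂ) *
      (jacobiTheta (-1 / (4 * δ)) - jacobiTheta (-1 / δ)) := by
  have h1 : jacobiTheta (δ - 1) = jacobiTheta (δ + 1) := by
    rw [← jacobiTheta_two_add]; congr 1; ring
  have h2 : δ ≠ 0 := by rintro rfl; simp at hδ
  have h3 : -Complex.I * δ ≠ 0 := mul_ne_zero (neg_ne_zero.2 Complex.I_ne_zero) h2
  have h4 : (-Complex.I * (4 * δ)) ^ (1 / 2 : ℂ) = 2 * (-Complex.I * δ) ^ (1 / 2 : ℂ) := by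
    have e : -Complex.I * (4 * δ) = ((4 : ℝ) : ℂ) * (-Complex.I * δ) := by push_cast; ring
    have h5 : ((4 : ℝ) : ℂ) * (-Complex.I * δ) ≠ 0 := mul_ne_zero (by norm_num) h3
    have h6 : Real.log 4 = 2 * Real.log 2 := by
      rw [show (4 : ℝ) = 2 ^ 2 by norm_num, Real.log_pow]; norm_num
    rw [e, Complex.cpow_def_of_ne_zero h5, Complex.cpow_def_of_ne_zero h3,
      Complex.log_ofReal_mul (by norm_num) h3, add_mul, Complex.exp_add, h6]
    congr 1
    rw [show (((2 * Real.log 2 : ℝ) : ℂ) * (1 / 2)) = ((Real.log 2 : ℝ) : ℂ) by push_cast; ring,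
      ← Complex.ofReal_exp, Real.exp_log two_pos]
    norm_num
  have h7 : (-Complex.I * δ) ^ (1 / 2 : ℂ) ≠ 0 := by
    rw [Ne, Complex.cpow_eq_zero_iff]; exact fun h ↦ h3 h.1
  have h8 := jacobiTheta_add_one_add_self hδ
  rw [jacobiTheta_eq_inv_sqrt_mul (4 * δ), h4, jacobiTheta_eq_inv_sqrt_mul δ] at h8
  rw [h1, eq_sub_of_add_eq h8]
  field_simp

/-- Rapid decay of the theta function near the cusp `-1`. -/
theorem exists_norm_jacobiTheta_sub_one_le : ∃ C : ℝ, 0 ≤ C ∧ ∀ δ : ℂ, δ ≠ 0 → ‖δ‖ ≤ 1 →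
    ‖δ‖ / 2 ≤ δ.im → ‖jacobiTheta (δ - 1)‖ ≤ C * ‖δ‖ ^ 3 := by
  set r := Real.exp (-(1 / 4)) with hr
  have hr1 : r < 1 := by rw [hr, Real.exp_lt_one_iff]; norm_num
  have hr0 : 0 < 1 - r := by linarith
  refine ⟨2 * (2 / (1 - r)) * (4 ^ 4 * 24), by positivity, fun δ hδ0 hδ1 hδi ↦ ?_⟩
  have hn : 0 < ‖δ‖ := norm_pos_iff.2 hδ0
  have him : 0 < δ.im := by linarith
  set v := ‖δ‖⁻¹ with hv
  have hv1 : 1 ≤ v := (one_le_inv₀ hn).2 hδ1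
  have hv0 : 0 < v := by linarith
  have hbound : ∀ τ : ℂ, v / 8 ≤ τ.im → ‖jacobiTheta τ - 1‖ ≤ 2 / (1 - r) * Real.exp (-(v / 4)) := by
    intro τ hτ
    have hτ0 : 0 < τ.im := by linarith
    refine (norm_jacobiTheta_sub_one_le hτ0).trans ?_
    have h1 : Real.exp (-Real.pi * τ.im) ≤ Real.exp (-(v / 4)) := by
      apply Real.exp_le_exp.2
      nlinarith [Real.pi_gt_three]
    have h2 : Real.exp (-(v / 4)) ≤ r := by
      apply Real.exp_le_exp.2
      linarith
    have h3 := h1.trans h2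
    gcongr
  have him1 : ∀ c : ℝ, 0 < c → (-1 / ((c : ℂ) * δ)).im = δ.im / (c * ‖δ‖ ^ 2) := by
    intro c hc
    rw [neg_div, Complex.neg_im, one_div, Complex.inv_im, Complex.normSq_eq_norm_sq, norm_mul,
      Complex.norm_real, Real.norm_of_nonneg hc.le, Complex.im_ofReal_mul]
    field_simp
  have hA : v / 8 ≤ (-1 / (4 * δ)).im := by
    have := him1 4 (by norm_num)
    push_cast at this
    rw [this, hv, le_div_iff₀ (by positivity)]
    have : ‖δ‖⁻¹ / 8 * (4 * ‖δ‖ ^ 2) = ‖δ‖ / 2 := by field_simp; norm_num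
    linarith
  have hB : v / 8 ≤ (-1 / δ).im := by
    have := him1 1 (by norm_num)
    push_cast at this
    rw [one_mul, one_mul] at this
    rw [this, hv, le_div_iff₀ (by positivity)]
    have : ‖δ‖⁻¹ / 8 * (‖δ‖ ^ 2) = ‖δ‖ / 8 := by field_simp
    linarith
  have h1 : ‖jacobiTheta (-1 / (4 * δ)) - jacobiTheta (-1 / δ)‖ ≤
      2 * (2 / (1 - r) * Real.exp (-(v / 4))) := by
    have : jacobiTheta (-1 / (4 * δ)) - jacobiTheta (-1 / δ) =
      (jacobiTheta (-1 / (4 * δ)) - 1) - (jacobiTheta (-1 / δ) - 1) := by ring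
    rw [this]
    refine (norm_sub_le _ _).trans ?_
    linarith [hbound _ hA, hbound _ hB]
  have h2 : ‖(1 : ℂ) / (-Complex.I * δ) ^ (1 / 2 : ℂ)‖ ≤ v := by
    have e : (1 / 2 : ℂ) = ((1 / 2 : ℝ) : ℂ) := by push_cast; rfl
    rw [norm_div, norm_one, e, Complex.norm_cpow_real, norm_mul, norm_neg, Complex.norm_I, one_mul,
      hv, one_div]
    apply inv_anti₀ hn
    calc ‖δ‖ = ‖δ‖ ^ (1 : ℝ) := (Real.rpow_one _).symm
      _ ≤ _ := Real.rpow_le_rpow_of_exponent_ge hn hδ1 (by norm_num)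
  -- From `t⁴/4! ≤ e^t` at `t = v/4`. One power of `v` pays for the square-root prefactor; the other
  -- three give `‖δ‖³`.
  have h3 : v ^ 4 * Real.exp (-(v / 4)) ≤ 4 ^ 4 * 24 := by
    have := Real.pow_div_factorial_le_exp (v / 4) (by positivity) 4
    rw [Real.exp_neg, ← div_eq_mul_inv, div_le_iff₀ (Real.exp_pos _)]
    rw [show (Nat.factorial 4 : ℝ) = 24 by norm_num [Nat.factorial]] at this
    rw [div_le_iff₀ (by norm_num), div_pow, div_le_iff₀ (by norm_num)] at this
    linarith
  rw [jacobiTheta_sub_one him, norm_mul]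
  calc _ ≤ v * (2 * (2 / (1 - r) * Real.exp (-(v / 4)))) := by gcongr
    _ = 2 * (2 / (1 - r)) * (v ^ 4 * Real.exp (-(v / 4))) * ‖δ‖ ^ 3 := by
        rw [hv]; field_simp
    _ ≤ _ := by gcongr

/-- The argument is `-e^{-ik} = δ - 1` with `‖δ‖ ≤ k`. The cubic order is what a comparison of
second differences of size `k²` requires. -/
theorem exists_norm_jacobiTheta_ray_le : ∃ C : ℝ, 0 ≤ C ∧ ∀ k : ℝ, 0 < k → k ≤ 1 →
    ‖jacobiTheta (Complex.I * Complex.exp (((Real.pi / 2 - k : ℝ) : ℂ) * Complex.I))‖ ≤ C * k ^ 3 := by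
  obtain ⟨C, hC, h⟩ := exists_norm_jacobiTheta_sub_one_le
  refine ⟨C, hC, fun k hk hk1 ↦ ?_⟩
  set δ : ℂ := 1 - Complex.exp (Complex.I * ((-k : ℝ) : ℂ)) with hδ
  have e : Complex.I * Complex.exp (((Real.pi / 2 - k : ℝ) : ℂ) * Complex.I) = δ - 1 := by
    have : (((Real.pi / 2 - k : ℝ) : ℂ) * Complex.I) =
      Real.pi / 2 * Complex.I + Complex.I * ((-k : ℝ) : ℂ) := by push_cast; ring
    rw [this, Complex.exp_add, Complex.exp_pi_div_two_mul_I, hδ, ← mul_assoc, Complex.I_mul_I]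
    ring
  have hre : δ.re = 1 - Real.cos k := by
    rw [hδ, mul_comm, Complex.sub_re, Complex.exp_ofReal_mul_I_re]; simp
  have him : δ.im = Real.sin k := by
    rw [hδ, mul_comm, Complex.sub_im, Complex.exp_ofReal_mul_I_im]; simp
  have hsin : 0 < Real.sin k := Real.sin_pos_of_pos_of_lt_pi hk (by linarith [Real.pi_gt_three])
  have hcos : 0 ≤ Real.cos k := Real.cos_nonneg_of_mem_Icc
    ⟨by linarith [Real.pi_gt_three], by linarith [Real.pi_gt_three]⟩
  have hδk : ‖δ‖ ≤ k := by
    rw [hδ, norm_sub_rev]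
    refine Real.norm_exp_I_mul_ofReal_sub_one_le.trans ?_
    simp [abs_of_pos hk]
  have hδ0 : δ ≠ 0 := fun h0 ↦ by rw [h0] at him; simp at him; linarith
  -- Amounts to `2(1 - cos k) ≤ 4 sin² k`, true since `cos k ≥ 0`.
  have hhalf : ‖δ‖ / 2 ≤ δ.im := by
    rw [him, div_le_iff₀ two_pos]
    apply abs_le_of_sq_le_sq' _ (by positivity) |>.2
    rw [← Complex.normSq_eq_norm_sq, Complex.normSq_apply, hre, him]
    nlinarith [Real.sin_sq_add_cos_sq k, Real.cos_le_one k]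
  rw [e]
  exact (h δ hδ0 (hδk.trans hk1) hhalf).trans (by gcongr)

/-! ### The Laplace transform of the completed zeta function on the critical line. -/

theorem integrable_exp_neg_mul_abs {c : ℝ} (hc : 0 < c) :
    Integrable (fun y : ℝ ↦ Real.exp (-(c * |y|))) := by
  refine (integrable_inv_one_add_sq.const_mul (1 + 2 / c ^ 2)).mono'
    (by fun_prop) (Eventually.of_forall fun y ↦ ?_)
  rw [Real.norm_of_nonneg (Real.exp_pos _).le, Real.exp_neg, ← div_eq_mul_inv,
    inv_le_comm₀ (Real.exp_pos _) (by positivity), inv_div]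
  refine le_trans ?_ (Real.quadratic_le_exp_of_nonneg (x := c * |y|) (by positivity))
  rw [div_le_iff₀ (by positivity), mul_pow, sq_abs]
  have h1 : c ^ 2 * y ^ 2 / 2 * (2 / c ^ 2) = y ^ 2 := by field_simp
  have h2 : 0 ≤ c * |y| := by positivity
  have h3 : 0 ≤ 2 / c ^ 2 := by positivity
  have h4 : 0 ≤ c ^ 2 * y ^ 2 / 2 := by positivity
  nlinarith [mul_nonneg h2 h3]

/-- Twice the completed zeta function on the critical line, which is real. -/
noncomputable def critZeta (y : ℝ) : ℝ := 2 * (completedRiemannZeta (critPoint y)).re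

theorem ofReal_critZeta (y : ℝ) : (critZeta y : ℂ) = 2 * completedRiemannZeta (critPoint y) := by
  have := Complex.conj_eq_iff_re.1 (completedRiemannZeta_critPoint_conj y)
  rw [critZeta]
  push_cast
  rw [this]

theorem continuous_critZeta : Continuous critZeta := by
  have h : Continuous fun y ↦ completedRiemannZeta (critPoint y) := by
    refine continuous_iff_continuousAt.2 fun y ↦ ?_
    refine ContinuousAt.comp (f := critPoint)
      (differentiableAt_completedZeta (critPoint_ne_zero y) (critPoint_ne_one y)).continuousAt ?_
    unfold critPoint
    fun_prop
  exact (Complex.continuous_re.comp h).const_mul 2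

theorem one_add_le_mul_exp {d : ℝ} (hd : 0 < d) {t : ℝ} (ht : 0 ≤ t) :
    1 + t ≤ (1 + 1 / d) * Real.exp (d * t) := by
  have h1 := Real.add_one_le_exp (d * t)
  have h2 : 0 ≤ d * t := by positivity
  have h3 : (1 / d) * (d * t) = t := by field_simp
  have h4 : 0 < 1 / d := by positivity
  nlinarith [mul_le_mul_of_nonneg_left h1 h4.le]

/-- Gamma decays at rate `π/2` and zeta grows at most linearly, so any smaller rate `a` survives. -/
theorem exists_abs_critZeta_le {a : ℝ} (ha : a < Real.pi / 2) :
    ∃ C : ℝ, 0 ≤ C ∧ ∀ y, |critZeta y| ≤ C * Real.exp (-(a * |y|)) := by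
  obtain ⟨G, hG⟩ := norm_Gamma_quarter_le
  set S : ℝ := ∑' k : ℕ, ((k : ℝ) + 1) ^ (-(1 / 2 + 1) : ℝ) with hS
  have hS0 : 0 ≤ S := tsum_nonneg fun k ↦ by positivity
  have hG0 : 0 ≤ G := by
    have := (norm_nonneg _).trans (hG 0)
    simpa using this
  set d := Real.pi / 2 - a with hd
  have hd0 : 0 < d := by linarith
  have hzeta : ∀ y : ℝ, ‖riemannZeta (critPoint y)‖ ≤ (3 + 2 * S) * (1 + |y|) := by
    intro y
    have h := norm_riemannZeta_le (s := critPoint y) (by simp) (critPoint_ne_one y)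
    rw [critPoint_re, ← hS] at h
    have h1 : ‖1 - 1 / (1 - critPoint y)‖ ≤ 3 := by
      refine (norm_sub_le _ _).trans ?_
      rw [norm_div, norm_one]
      have : 1 / 2 ≤ ‖1 - critPoint y‖ := by
        refine le_trans ?_ (Complex.abs_re_le_norm _)
        rw [Complex.sub_re, critPoint_re]
        norm_num
      have : 1 / ‖1 - critPoint y‖ ≤ 1 / (1 / 2) := by gcongr
      linarith
    have h2 : ‖critPoint y‖ ≤ 2 * (1 + |y|) := by
      rw [critPoint_eq]
      refine (norm_add_le _ _).trans ?_
      simp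
      linarith [abs_nonneg y]
    have h3 : ‖critPoint y‖ * S ≤ 2 * (1 + |y|) * S := by gcongr
    nlinarith [abs_nonneg y]
  refine ⟨2 * G * (3 + 2 * S) * (1 + 1 / d), by positivity, fun y ↦ ?_⟩
  rw [← Real.norm_eq_abs, ← Complex.norm_real, ofReal_critZeta,
    completedRiemannZeta_eq_Gammaℝ_mul (by simp), norm_mul, norm_mul, Complex.norm_two,
    Complex.Gammaℝ_def, norm_mul]
  have e : critPoint y / 2 = (1 / 4 : ℝ) + y * Complex.I := by rw [critPoint]; ring
  have h1 : ‖(Real.pi : ℂ) ^ (-critPoint y / 2)‖ ≤ 1 := by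
    rw [Complex.norm_cpow_eq_rpow_re_of_pos Real.pi_pos]
    apply Real.rpow_le_one_of_one_le_of_nonpos (by linarith [Real.pi_gt_three])
    rw [neg_div, Complex.neg_re, e]
    simp
  rw [e]
  calc 2 * (‖(Real.pi : ℂ) ^ (-critPoint y / 2)‖ * ‖Complex.Gamma ((1 / 4 : ℝ) + y * Complex.I)‖ *
        ‖riemannZeta (critPoint y)‖)
      ≤ 2 * (1 * (G * Real.exp (-(Real.pi / 2 * |y|))) * ((3 + 2 * S) * (1 + |y|))) := by
        gcongr
        · exact hG y
        · exact hzeta y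
    _ ≤ 2 * (1 * (G * Real.exp (-(Real.pi / 2 * |y|))) *
          ((3 + 2 * S) * ((1 + 1 / d) * Real.exp (d * |y|)))) := by
        gcongr
        exact one_add_le_mul_exp hd0 (abs_nonneg y)
    _ = 2 * G * (3 + 2 * S) * (1 + 1 / d) *
          (Real.exp (-(Real.pi / 2 * |y|)) * Real.exp (d * |y|)) := by ring
    _ = _ := by
        rw [← Real.exp_add, hd]
        congr 2
        ring

/-- The two-sided Laplace transform of the completed zeta function on the critical line. -/
noncomputable def critLaplace (z : ℂ) : ℂ := ∫ y : ℝ, Complex.exp (z * y) * critZeta y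

theorem norm_exp_mul_critZeta_le {a C : ℝ} (hC : ∀ y, |critZeta y| ≤ C * Real.exp (-(a * |y|)))
    {b : ℝ} {z : ℂ} (hz : |z.re| ≤ b) (y : ℝ) :
    ‖Complex.exp (z * y) * critZeta y‖ ≤ C * Real.exp (-((a - b) * |y|)) := by
  rw [norm_mul, Complex.norm_exp, Complex.norm_real, Real.norm_eq_abs]
  have h1 : (z * y).re ≤ b * |y| := by
    rw [Complex.re_mul_ofReal]
    refine (le_abs_self _).trans ?_
    rw [abs_mul]
    gcongr
  calc _ ≤ Real.exp (b * |y|) * (C * Real.exp (-(a * |y|))) := by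
        gcongr
        exact hC y
    _ = C * (Real.exp (b * |y|) * Real.exp (-(a * |y|))) := by ring
    _ = _ := by rw [← Real.exp_add]; congr 2; ring

theorem integrable_exp_mul_critZeta {z : ℂ} (hz : |z.re| < Real.pi / 2) :
    Integrable fun y : ℝ ↦ Complex.exp (z * y) * critZeta y := by
  obtain ⟨a, ha, ha'⟩ := exists_between hz
  obtain ⟨C, -, hC⟩ := exists_abs_critZeta_le ha'
  refine ((integrable_exp_neg_mul_abs (sub_pos.2 ha)).const_mul C).mono' ?_
    (Eventually.of_forall fun y ↦ norm_exp_mul_critZeta_le hC le_rfl y)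
  have := continuous_critZeta
  exact Continuous.aestronglyMeasurable (by fun_prop)

theorem differentiableAt_critLaplace {z : ℂ} (hz : |z.re| < Real.pi / 2) :
    DifferentiableAt ℂ critLaplace z := by
  obtain ⟨b, hb, hb'⟩ := exists_between hz
  obtain ⟨a, ha, ha'⟩ := exists_between hb'
  obtain ⟨C, hC0, hC⟩ := exists_abs_critZeta_le ha'
  have hcont := continuous_critZeta
  set d := (a - b) / 2 with hd
  have hd0 : 0 < d := by rw [hd]; linarith
  have hs : {w : ℂ | |w.re| < b} ∈ 𝓝 z :=
    (isOpen_lt (by fun_prop) continuous_const).mem_nhds hb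
  refine (hasDerivAt_integral_of_dominated_loc_of_deriv_le (μ := volume)
    (F := fun (w : ℂ) (y : ℝ) ↦ Complex.exp (w * y) * critZeta y)
    (F' := fun (w : ℂ) (y : ℝ) ↦ (y : ℂ) * (Complex.exp (w * y) * critZeta y))
    (bound := fun y ↦ (1 + 1 / d) * C * Real.exp (-(d * |y|))) hs
    (Eventually.of_forall fun w ↦ Continuous.aestronglyMeasurable (by fun_prop))
    (integrable_exp_mul_critZeta hz)
    (Continuous.aestronglyMeasurable (by fun_prop))
    (Eventually.of_forall fun y w hw ↦ ?_)
    ((integrable_exp_neg_mul_abs hd0).const_mul _)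
    (Eventually.of_forall fun y w _ ↦ ?_)).2.differentiableAt
  · rw [norm_mul, Complex.norm_real, Real.norm_eq_abs]
    have h1 := norm_exp_mul_critZeta_le hC (le_of_lt hw) y
    have h2 : |y| ≤ (1 + 1 / d) * Real.exp (d * |y|) := by
      linarith [one_add_le_mul_exp hd0 (abs_nonneg y)]
    calc _ ≤ ((1 + 1 / d) * Real.exp (d * |y|)) * (C * Real.exp (-((a - b) * |y|))) := by
          gcongr
      _ = (1 + 1 / d) * C * (Real.exp (d * |y|) * Real.exp (-((a - b) * |y|))) := by ring
      _ = _ := by rw [← Real.exp_add]; congr 2; rw [hd]; ring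
  · have h1 : HasDerivAt (fun w : ℂ ↦ w * (y : ℂ)) (y : ℂ) w := by
      simpa using (hasDerivAt_id w).mul_const (y : ℂ)
    exact ((h1.cexp).mul_const (critZeta y : ℂ)).congr_deriv (by ring)

theorem continuousAt_thetaKernel {x : ℝ} (hx : 0 < x) : ContinuousAt thetaKernel x := by
  unfold thetaKernel
  have h1 : ContinuousAt (fun x : ℝ ↦ jacobiTheta (Complex.I * x)) x :=
    ContinuousAt.comp (f := fun x : ℝ ↦ Complex.I * x) (continuousAt_jacobiTheta (by simpa))
      (by fun_prop)
  refine (h1.sub continuousAt_const).sub ?_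
  exact (hasDerivAt_ofReal_cpow_const hx.ne' (by norm_num)).continuousAt

/-- On the imaginary axis the transform is a Fourier integral, namely Mellin inversion along `Re s =
1/4` at the point `e^{-u}`. -/
theorem critLaplace_mul_I (u : ℝ) :
    critLaplace (u * Complex.I) =
      2 * Real.pi * (Complex.exp (-(u / 4)) * thetaKernel (Real.exp (-u))) := by
  have hm : ∀ y : ℝ, mellin thetaKernel ((1 / 4 : ℝ) + y * Complex.I) = critZeta y := by
    intro y
    rw [ofReal_critZeta, (hasMellin_thetaKernel (by norm_num) (by norm_num)).2, critPoint]
  have hint : Complex.VerticalIntegrable (mellin thetaKernel) (1 / 4 : ℝ) := by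
    rw [Complex.VerticalIntegrable]
    simp only [hm]
    simpa using integrable_exp_mul_critZeta (z := 0) (by simpa using Real.pi_pos)
  have h := mellinInv_mellin_eq (1 / 4 : ℝ) thetaKernel (Real.exp_pos (-u))
    (hasMellin_thetaKernel (by norm_num) (by norm_num)).1 hint
    (continuousAt_thetaKernel (Real.exp_pos _))
  rw [← h, mellinInv, critLaplace]
  simp only [hm]
  have hpow : ∀ y : ℝ, ((Real.exp (-u) : ℝ) : ℂ) ^ (-(((1 / 4 : ℝ) : ℂ) + y * Complex.I)) =
      Complex.exp (u / 4) * Complex.exp (u * Complex.I * y) := by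
    intro y
    rw [Complex.cpow_def_of_ne_zero (by exact_mod_cast (Real.exp_pos _).ne'),
      ← Complex.ofReal_log (Real.exp_pos _).le, Real.log_exp, ← Complex.exp_add]
    congr 1
    push_cast
    ring
  simp only [hpow, smul_eq_mul, mul_assoc]
  rw [integral_const_mul, Complex.real_smul]
  have hpi : (Real.pi : ℂ) ≠ 0 := by exact_mod_cast Real.pi_ne_zero
  have he : Complex.exp (-(u / 4)) * Complex.exp (u / 4) = 1 := by
    rw [← Complex.exp_add, neg_add_cancel, Complex.exp_zero]
  set J := ∫ y : ℝ, Complex.exp (u * (Complex.I * y)) * critZeta y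
  push_cast
  calc J = (Complex.exp (-(u / 4)) * Complex.exp (u / 4)) * J := by rw [he, one_mul]
    _ = _ := by field_simp

/-- Both sides are analytic in the strip, which is where `i e^{iz}` stays in the upper half-plane.
They agree on the imaginary axis, in particular at the points `i/(n+1)` accumulating at `0`. -/
theorem critLaplace_eq {z : ℂ} (hz : |z.re| < Real.pi / 2) :
    critLaplace z = 2 * Real.pi * (Complex.exp (z * Complex.I / 4) *
      (jacobiTheta (Complex.I * Complex.exp (z * Complex.I)) - 1) -
        Complex.exp (-(z * Complex.I / 4))) := by
  set U : Set ℂ := {w | |w.re| < Real.pi / 2} with hU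
  have hUo : IsOpen U := isOpen_lt (by fun_prop) continuous_const
  have hUc : Convex ℝ U := by
    have : U = Complex.reLm ⁻¹' (Set.Ioo (-(Real.pi / 2)) (Real.pi / 2)) := by
      ext w; simp [hU, abs_lt]
    rw [this]
    exact (convex_Ioo _ _).linear_preimage _
  have hF : DifferentiableOn ℂ critLaplace U := fun w hw ↦
    (differentiableAt_critLaplace hw).differentiableWithinAt
  have hH : DifferentiableOn ℂ (fun z ↦ 2 * Real.pi * (Complex.exp (z * Complex.I / 4) *
      (jacobiTheta (Complex.I * Complex.exp (z * Complex.I)) - 1) -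
        Complex.exp (-(z * Complex.I / 4)))) U := by
    intro w hw
    have him : 0 < (Complex.I * Complex.exp (w * Complex.I)).im := by
      rw [Complex.I_mul_im, Complex.exp_re]
      refine mul_pos (Real.exp_pos _) (Real.cos_pos_of_mem_Ioo ?_)
      have := abs_lt.1 (show |w.re| < Real.pi / 2 from hw)
      simpa using this
    have h1 : DifferentiableAt ℂ
        (fun z ↦ jacobiTheta (Complex.I * Complex.exp (z * Complex.I))) w :=
      (differentiableAt_jacobiTheta him).comp w
        (f := fun z ↦ Complex.I * Complex.exp (z * Complex.I)) (by fun_prop)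
    exact DifferentiableAt.differentiableWithinAt (by fun_prop)
  have h0 : (0 : ℂ) ∈ U := by simp [hU, Real.pi_pos]
  refine (hF.analyticOnNhd hUo).eqOn_of_preconnected_of_frequently_eq (hH.analyticOnNhd hUo)
    hUc.isPreconnected h0 ?_ hz
  have htend : Tendsto (fun n : ℕ ↦ ((1 / ((n : ℝ) + 1) : ℝ) : ℂ) * Complex.I) atTop (𝓝[≠] 0) := by
    refine tendsto_nhdsWithin_iff.2 ⟨?_, Eventually.of_forall fun n ↦ ?_⟩
    · have := ((Complex.continuous_ofReal.tendsto 0).comp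
        tendsto_one_div_add_atTop_nhds_zero_nat).mul_const Complex.I
      simpa [Function.comp_def] using this
    · refine mul_ne_zero ?_ Complex.I_ne_zero
      exact_mod_cast (by positivity : (1 / ((n : ℝ) + 1) : ℝ) ≠ 0)
  refine htend.frequently (Frequently.of_forall fun n ↦ ?_)
  set u : ℝ := 1 / ((n : ℝ) + 1)
  rw [critLaplace_mul_I, thetaKernel]
  have e1 : (u : ℂ) * Complex.I * Complex.I = -u := by rw [mul_assoc, Complex.I_mul_I]; ring
  have e2 : ((Real.exp (-u) : ℝ) : ℂ) ^ (-(1 / 2) : ℂ) = Complex.exp (u / 2) := by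
    rw [Complex.cpow_def_of_ne_zero (by exact_mod_cast (Real.exp_pos _).ne'),
      ← Complex.ofReal_log (Real.exp_pos _).le, Real.log_exp]
    congr 1
    push_cast
    ring
  have e3 : Complex.exp (-(u / 4)) * Complex.exp (u / 2) = Complex.exp (u / 4) := by
    rw [← Complex.exp_add]; congr 1; ring
  rw [e1, e2, mul_sub, e3, neg_div, neg_neg]
  push_cast
  rfl

theorem integrable_rexp_mul_critZeta {x : ℝ} (hx : |x| < Real.pi / 2) :
    Integrable fun y : ℝ ↦ Real.exp (x * y) * critZeta y := by
  have h := (integrable_exp_mul_critZeta (z := x) (by simpa)).re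
  refine h.congr (Eventually.of_forall fun y ↦ ?_)
  simp only [RCLike.re_to_complex, Complex.re_mul_ofReal]
  rw [← Complex.ofReal_mul, ← Complex.ofReal_exp, Complex.ofReal_re]

/-- On the real axis the Laplace transform is `-4π cos (x/4)` up to a small error near `π/2`. -/
theorem exists_abs_critLaplace_add_le : ∃ C : ℝ, 0 ≤ C ∧ ∀ k : ℝ, 0 < k → k ≤ 1 →
    |(∫ y : ℝ, Real.exp ((Real.pi / 2 - k) * y) * critZeta y) +
      4 * Real.pi * Real.cos ((Real.pi / 2 - k) / 4)| ≤ C * k ^ 3 := by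
  obtain ⟨C, hC, h⟩ := exists_norm_jacobiTheta_ray_le
  refine ⟨2 * Real.pi * C, by positivity, fun k hk hk1 ↦ ?_⟩
  have hpi := Real.pi_gt_three
  set x := Real.pi / 2 - k with hx
  have hxa : |x| < Real.pi / 2 := by rw [abs_lt, hx]; constructor <;> linarith
  have h1 := critLaplace_eq (z := x) (by simpa)
  have h2 : critLaplace x = ((∫ y : ℝ, Real.exp (x * y) * critZeta y : ℝ) : ℂ) := by
    rw [critLaplace, ← integral_complex_ofReal]
    simp
  have h3 : (4 * Real.pi * Real.cos (x / 4) : ℝ) =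
      2 * Real.pi * (Complex.exp (x * Complex.I / 4) + Complex.exp (-(x * Complex.I / 4))) := by
    push_cast
    rw [Complex.cos]
    have e1 : (x : ℂ) / 4 * Complex.I = x * Complex.I / 4 := by ring
    have e2 : -((x : ℂ) / 4) * Complex.I = -(x * Complex.I / 4) := by ring
    rw [e1, e2]
    ring
  rw [← Real.norm_eq_abs, ← Complex.norm_real, Complex.ofReal_add, ← h2, h1, h3]
  have e : 2 * Real.pi * (Complex.exp (x * Complex.I / 4) *
      (jacobiTheta (Complex.I * Complex.exp (x * Complex.I)) - 1) -
        Complex.exp (-(x * Complex.I / 4))) +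
      2 * Real.pi * (Complex.exp (x * Complex.I / 4) + Complex.exp (-(x * Complex.I / 4))) =
      2 * Real.pi * Complex.exp (((x / 4 : ℝ) : ℂ) * Complex.I) *
        jacobiTheta (Complex.I * Complex.exp (x * Complex.I)) := by
    have e1 : ((x / 4 : ℝ) : ℂ) * Complex.I = x * Complex.I / 4 := by push_cast; ring
    rw [e1]
    ring
  rw [e, norm_mul, norm_mul, Complex.norm_exp_ofReal_mul_I, mul_one, norm_mul, Complex.norm_two,
    Complex.norm_real, Real.norm_of_nonneg Real.pi_pos.le, mul_assoc (2 * Real.pi)]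
  exact mul_le_mul_of_nonneg_left (h k hk hk1) (by positivity)

/-! ### The sign change and the zero on the critical line. -/

theorem not_forall_critZeta_nonneg : ¬ ∀ y, 0 ≤ critZeta y := by
  intro hpos
  obtain ⟨C, hC, h⟩ := exists_abs_critLaplace_add_le
  -- With `C k ≤ 1` the error is at most `1`, while the main term is at most `-4π · 1/2`.
  set k : ℝ := 1 / (1 + C) with hk
  have hk0 : 0 < k := by positivity
  have hk1 : k ≤ 1 := by rw [hk, div_le_one (by positivity)]; linarith
  have hCk : C * k ≤ 1 := by rw [hk, mul_one_div, div_le_one (by positivity)]; linarith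
  have h1 := (abs_le.1 (h k hk0 hk1)).2
  have h2 : 0 ≤ ∫ y : ℝ, Real.exp ((Real.pi / 2 - k) * y) * critZeta y :=
    integral_nonneg fun y ↦ mul_nonneg (Real.exp_pos _).le (hpos y)
  have hpi := Real.pi_gt_three
  have hpi4 := Real.pi_le_four
  have h3 : 1 / 2 ≤ Real.cos ((Real.pi / 2 - k) / 4) := by
    rw [← Real.cos_pi_div_three]
    apply Real.cos_le_cos_of_nonneg_of_le_pi <;> linarith
  have h4 : C * k ^ 3 ≤ 1 := by
    calc C * k ^ 3 = (C * k) * k ^ 2 := by ring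
      _ ≤ 1 * 1 ^ 2 := by gcongr
      _ = 1 := by norm_num
  nlinarith

/-- A nonpositive integrand makes the transform concave, since `e^{ky} + e^{-ky} ≥ 2`. The second
difference of `-4π cos (x/4)` is positive of order `k²` and cannot be offset by an error `O(k³)`. -/
theorem not_forall_critZeta_nonpos : ¬ ∀ y, critZeta y ≤ 0 := by
  intro hneg
  obtain ⟨C, hC, h⟩ := exists_abs_critLaplace_add_le
  have hpi := Real.pi_gt_three
  have hpi4 := Real.pi_le_four
  -- The three sample points `k`, `2k`, `3k` have errors adding up to `(1 + 2·8 + 27) C k³`.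
  have key : ∀ k : ℝ, 0 < k → k ≤ 1 / 3 → k ^ 2 / 16 ≤ 44 * C * k ^ 3 := by
    intro k hk hk3
    set x := Real.pi / 2 - 2 * k with hx
    have h1 := h k hk (by linarith)
    have h2 := h (2 * k) (by linarith) (by linarith)
    have h3 := h (3 * k) (by linarith) (by linarith)
    have i1 := integrable_rexp_mul_critZeta (x := Real.pi / 2 - k)
      (by rw [abs_lt]; constructor <;> linarith)
    have i2 := integrable_rexp_mul_critZeta (x := Real.pi / 2 - 2 * k)
      (by rw [abs_lt]; constructor <;> linarith)
    have i3 := integrable_rexp_mul_critZeta (x := Real.pi / 2 - 3 * k)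
      (by rw [abs_lt]; constructor <;> linarith)
    have hconv : (∫ y : ℝ, Real.exp ((Real.pi / 2 - k) * y) * critZeta y) +
        (∫ y : ℝ, Real.exp ((Real.pi / 2 - 3 * k) * y) * critZeta y) ≤
        2 * ∫ y : ℝ, Real.exp ((Real.pi / 2 - 2 * k) * y) * critZeta y := by
      rw [← integral_add i1 i3, ← integral_const_mul]
      refine integral_mono (i1.add i3) (i2.const_mul 2) fun y ↦ ?_
      simp only
      have e1 : Real.exp ((Real.pi / 2 - k) * y) =
          Real.exp ((Real.pi / 2 - 2 * k) * y) * Real.exp (k * y) := by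
        rw [← Real.exp_add]; congr 1; ring
      have e2 : Real.exp ((Real.pi / 2 - 3 * k) * y) =
          Real.exp ((Real.pi / 2 - 2 * k) * y) * Real.exp (-(k * y)) := by
        rw [← Real.exp_add]; congr 1; ring
      have e3 : 2 ≤ Real.exp (k * y) + Real.exp (-(k * y)) := by
        have := Real.one_le_cosh (k * y)
        rw [Real.cosh_eq] at this
        linarith
      rw [e1, e2]
      have := mul_nonneg (mul_nonneg (Real.exp_pos ((Real.pi / 2 - 2 * k) * y)).le
        (neg_nonneg.2 (hneg y))) (sub_nonneg.2 e3)
      linarith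
    have hcos : Real.cos ((Real.pi / 2 - k) / 4) + Real.cos ((Real.pi / 2 - 3 * k) / 4) =
        2 * Real.cos (x / 4) * (1 - 2 * Real.sin (k / 8) ^ 2) := by
      have e1 : (Real.pi / 2 - k) / 4 = x / 4 + k / 4 := by rw [hx]; ring
      have e2 : (Real.pi / 2 - 3 * k) / 4 = x / 4 - k / 4 := by rw [hx]; ring
      have e3 : Real.cos (k / 4) = 1 - 2 * Real.sin (k / 8) ^ 2 := by
        rw [show k / 4 = 2 * (k / 8) by ring, Real.cos_two_mul, Real.cos_sq']; ring
      rw [e1, e2, Real.cos_add, Real.cos_sub, ← e3]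
      ring
    have hx2 : 1 / 2 ≤ Real.cos (x / 4) := by
      rw [← Real.cos_pi_div_three]
      apply Real.cos_le_cos_of_nonneg_of_le_pi <;> linarith
    have hsin : k / 16 ≤ Real.sin (k / 8) := by
      refine le_trans ?_ (Real.mul_le_sin (by linarith) (by linarith))
      rw [div_mul_eq_mul_div, le_div_iff₀ Real.pi_pos]
      nlinarith
    have hsin2 : (k / 16) ^ 2 ≤ Real.sin (k / 8) ^ 2 := by gcongr
    have hprod : 1 / 2 * (k / 16) ^ 2 ≤ Real.cos (x / 4) * Real.sin (k / 8) ^ 2 := by gcongr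
    have a1 := (abs_le.1 h1).1
    have a2 := (abs_le.1 h2).2
    have a3 := (abs_le.1 h3).1
    have hmain : 16 * Real.pi * (Real.cos (x / 4) * Real.sin (k / 8) ^ 2) ≤ 44 * C * k ^ 3 := by
      have e : 4 * Real.pi * (Real.cos ((Real.pi / 2 - k) / 4) +
          Real.cos ((Real.pi / 2 - 3 * k) / 4)) =
          2 * (4 * Real.pi * Real.cos (x / 4)) -
            16 * Real.pi * (Real.cos (x / 4) * Real.sin (k / 8) ^ 2) := by
        rw [hcos]; ring
      linarith
    have hlow : 16 * 3 * (1 / 2 * (k / 16) ^ 2) ≤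
        16 * Real.pi * (Real.cos (x / 4) * Real.sin (k / 8) ^ 2) := by gcongr
    have hk2 : 0 ≤ k ^ 2 := sq_nonneg k
    linarith
  -- Then `1000 C k < 1`, and `44/1000 < 1/16` contradicts `key`.
  set k : ℝ := 1 / (3 + 1000 * C) with hk
  have hk0 : 0 < k := by positivity
  have hk3 : k ≤ 1 / 3 := by
    rw [hk]
    gcongr
    linarith
  have hCk : 1000 * C * k < 1 := by
    rw [hk, mul_one_div, div_lt_one (by positivity)]; linarith
  have h1 := key k hk0 hk3
  have hk2 : 0 < k ^ 2 := by positivity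
  have h2 : 44 * C * k ^ 3 ≤ 44 / 1000 * k ^ 2 := by
    calc 44 * C * k ^ 3 = 44 / 1000 * ((1000 * C * k) * k ^ 2) := by ring
      _ ≤ 44 / 1000 * (1 * k ^ 2) := by gcongr
      _ = _ := by ring
  linarith

theorem exists_zero_on_critical_line : ∃ γ : ℝ, γ ≠ 0 ∧ riemannZeta (1 / 2 + γ * Complex.I) = 0 := by
  obtain ⟨y₁, h₁⟩ := not_forall.1 not_forall_critZeta_nonneg
  obtain ⟨y₂, h₂⟩ := not_forall.1 not_forall_critZeta_nonpos
  obtain ⟨y, hy⟩ : ∃ y, critZeta y = 0 :=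
    mem_range_of_exists_le_of_exists_ge continuous_critZeta ⟨y₁, (not_le.1 h₁).le⟩
      ⟨y₂, (not_le.1 h₂).le⟩
  have h := ofReal_critZeta y
  rw [hy, completedRiemannZeta_eq_Gammaℝ_mul (by simp)] at h
  have hz : riemannZeta (critPoint y) = 0 := by
    have hG := Complex.Gammaℝ_ne_zero_of_re_pos (s := critPoint y) (by simp)
    simpa [hG] using h.symm
  rw [critPoint_eq] at hz
  refine ⟨2 * y, ?_, by exact_mod_cast hz⟩
  rintro h0
  have hy0 : y = 0 := by linarith
  rw [hy0] at hz
  exact riemannZeta_half_ne_zero (by simpa using hz)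

/-! ### The oscillating counting function and the lengths it defines. -/

/-- The exponent `1/2 + iγ`. -/
noncomputable def oscExp (γ : ℝ) : ℂ := 1 / 2 + γ * Complex.I

/-- The amplitude of the oscillation. -/
noncomputable def oscCoeff (γ : ℝ) : ℝ := 1 / (4 * (1 + ‖oscExp γ‖))

/-- The oscillating model counting function `y^{1/2} (1 + β cos (γ log y))`. -/
noncomputable def oscCount (γ y : ℝ) : ℝ :=
  ((y : ℂ) ^ (1 / 2 : ℂ) + oscCoeff γ * (y : ℂ) ^ oscExp γ).re

/-- The density of `oscCount`. -/
noncomputable def oscDensity (γ y : ℝ) : ℝ :=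
  (1 / 2 * (y : ℂ) ^ (1 / 2 - 1 : ℂ) + oscCoeff γ * (oscExp γ * (y : ℂ) ^ (oscExp γ - 1))).re

/-- The integral `∫_y^∞ t⁻¹ d(oscCount t)`. -/
noncomputable def oscTail (γ y : ℝ) : ℝ :=
  ((y : ℂ) ^ (1 / 2 - 1 : ℂ) +
    oscCoeff γ * (oscExp γ / (1 - oscExp γ) * (y : ℂ) ^ (oscExp γ - 1))).re

section Osc

variable (γ : ℝ)

@[simp] theorem oscExp_re : (oscExp γ).re = 1 / 2 := by simp [oscExp]

theorem one_sub_oscExp_ne_zero : 1 - oscExp γ ≠ 0 := fun h ↦ by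
  have := congrArg Complex.re h
  norm_num at this

theorem oscExp_ne_one : oscExp γ ≠ 1 := fun h ↦ one_sub_oscExp_ne_zero γ (by rw [h, sub_self])

theorem oscExp_ne_zero : oscExp γ ≠ 0 := fun h ↦ by
  have := congrArg Complex.re h
  norm_num at this

theorem oscCoeff_pos : 0 < oscCoeff γ := by unfold oscCoeff; positivity

theorem oscCoeff_le : oscCoeff γ ≤ 1 / 4 := by
  unfold oscCoeff
  gcongr
  linarith [norm_nonneg (oscExp γ)]

/-- This is what dictates the amplitude: the oscillating part of the density stays below its main
part `y^{-1/2}/2`, so the model counting function increases. -/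
theorem oscCoeff_mul_norm_le : oscCoeff γ * ‖oscExp γ‖ ≤ 1 / 4 := by
  unfold oscCoeff
  rw [div_mul_eq_mul_div, div_le_div_iff₀ (by positivity) (by norm_num)]
  linarith

theorem norm_cpow_oscExp {y : ℝ} (hy : 0 < y) : ‖(y : ℂ) ^ oscExp γ‖ = √y := by
  rw [Complex.norm_cpow_eq_rpow_re_of_pos hy, oscExp_re, Real.sqrt_eq_rpow]

theorem norm_cpow_oscExp_sub_one {y : ℝ} (hy : 0 < y) :
    ‖(y : ℂ) ^ (oscExp γ - 1)‖ = (√y)⁻¹ := by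
  rw [Complex.norm_cpow_eq_rpow_re_of_pos hy, Complex.sub_re, oscExp_re, Real.sqrt_eq_rpow,
    ← Real.rpow_neg hy.le]
  norm_num

theorem ofReal_cpow_half {y : ℝ} (hy : 0 < y) : (y : ℂ) ^ (1 / 2 : ℂ) = (√y : ℝ) := by
  rw [Real.sqrt_eq_rpow, Complex.ofReal_cpow hy.le]
  norm_num

theorem ofReal_cpow_half_sub_one {y : ℝ} (hy : 0 < y) :
    (y : ℂ) ^ (1 / 2 - 1 : ℂ) = ((√y)⁻¹ : ℝ) := by
  rw [Real.sqrt_eq_rpow, ← Real.rpow_neg hy.le, Complex.ofReal_cpow hy.le]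
  norm_num

theorem abs_oscCount_sub_le {y : ℝ} (hy : 0 < y) : |oscCount γ y - √y| ≤ √y / 4 := by
  rw [oscCount, ofReal_cpow_half hy, Complex.add_re, Complex.ofReal_re, add_sub_cancel_left]
  refine (Complex.abs_re_le_norm _).trans ?_
  rw [norm_mul, norm_cpow_oscExp γ hy, Complex.norm_real, Real.norm_of_nonneg (oscCoeff_pos γ).le]
  have := oscCoeff_le γ
  have := Real.sqrt_nonneg y
  nlinarith

theorem oscCount_le {y : ℝ} (hy : 0 < y) : oscCount γ y ≤ 5 / 4 * √y := by
  linarith [(abs_le.1 (abs_oscCount_sub_le γ hy)).2]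

theorem le_oscCount {y : ℝ} (hy : 0 < y) : 3 / 4 * √y ≤ oscCount γ y := by
  linarith [(abs_le.1 (abs_oscCount_sub_le γ hy)).1]

theorem oscCount_pos {y : ℝ} (hy : 0 < y) : 0 < oscCount γ y :=
  lt_of_lt_of_le (by have := Real.sqrt_pos.2 hy; positivity) (le_oscCount γ hy)

theorem oscDensity_pos {y : ℝ} (hy : 0 < y) : 0 < oscDensity γ y := by
  have h1 : |(oscCoeff γ * (oscExp γ * (y : ℂ) ^ (oscExp γ - 1))).re| ≤ 1 / 4 * (√y)⁻¹ := by
    refine (Complex.abs_re_le_norm _).trans ?_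
    rw [norm_mul, norm_mul, norm_cpow_oscExp_sub_one γ hy, Complex.norm_real,
      Real.norm_of_nonneg (oscCoeff_pos γ).le, ← mul_assoc]
    exact mul_le_mul_of_nonneg_right (oscCoeff_mul_norm_le γ) (by positivity)
  have h2 : 0 < (√y)⁻¹ := inv_pos.2 (Real.sqrt_pos.2 hy)
  rw [oscDensity, Complex.add_re, ofReal_cpow_half_sub_one hy]
  have h3 : ((1 / 2 : ℂ) * ((√y)⁻¹ : ℝ)).re = 1 / 2 * (√y)⁻¹ := by
    rw [Complex.re_mul_ofReal]; norm_num
  rw [h3]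
  linarith [(abs_le.1 h1).1]

theorem hasDerivAt_re {f : ℝ → ℂ} {f' : ℂ} {x : ℝ} (h : HasDerivAt f f' x) :
    HasDerivAt (fun y ↦ (f y).re) f'.re x := by
  exact Complex.reCLM.hasFDerivAt.comp_hasDerivAt x h

theorem hasDerivAt_oscCount {y : ℝ} (hy : 0 < y) :
    HasDerivAt (oscCount γ) (oscDensity γ y) y :=
  hasDerivAt_re ((hasDerivAt_ofReal_cpow_const hy.ne' (by norm_num)).add
    ((hasDerivAt_ofReal_cpow_const hy.ne' (oscExp_ne_zero γ)).const_mul _))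

theorem hasDerivAt_oscTail {y : ℝ} (hy : 0 < y) :
    HasDerivAt (oscTail γ) (-(oscDensity γ y / y)) y := by
  have h1 : oscExp γ - 1 ≠ 0 := sub_ne_zero.2 (oscExp_ne_one γ)
  have h := hasDerivAt_re ((hasDerivAt_ofReal_cpow_const hy.ne'
    (by norm_num : (1 / 2 - 1 : ℂ) ≠ 0)).add
    (((hasDerivAt_ofReal_cpow_const hy.ne' h1).const_mul
      (oscExp γ / (1 - oscExp γ))).const_mul (oscCoeff γ : ℂ)))
  refine h.congr_deriv ?_
  have hyc : (y : ℂ) ≠ 0 := by exact_mod_cast hy.ne'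
  rw [oscDensity, ← Complex.div_ofReal_re, ← Complex.neg_re]
  congr 1
  have h2 := one_sub_oscExp_ne_zero γ
  have e : ∀ z : ℂ, (y : ℂ) ^ (z - 1) = (y : ℂ) ^ z / y := fun z ↦ by
    rw [Complex.cpow_sub _ _ hyc, Complex.cpow_one]
  rw [e (1 / 2 - 1), e (oscExp γ - 1)]
  generalize (y : ℂ) ^ (1 / 2 - 1 : ℂ) = A
  generalize (y : ℂ) ^ (oscExp γ - 1) = B
  field_simp
  ring

theorem strictMonoOn_oscCount : StrictMonoOn (oscCount γ) (Set.Ioi 0) := by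
  refine strictMonoOn_of_deriv_pos (convex_Ioi 0)
    (fun y hy ↦ (hasDerivAt_oscCount γ hy).continuousAt.continuousWithinAt) fun y hy ↦ ?_
  rw [interior_Ioi] at hy
  rw [(hasDerivAt_oscCount γ hy).deriv]
  exact oscDensity_pos γ hy

theorem strictAntiOn_oscTail : StrictAntiOn (oscTail γ) (Set.Ioi 0) := by
  refine strictAntiOn_of_deriv_neg (convex_Ioi 0)
    (fun y hy ↦ (hasDerivAt_oscTail γ hy).continuousAt.continuousWithinAt) fun y hy ↦ ?_
  rw [interior_Ioi] at hy
  rw [(hasDerivAt_oscTail γ hy).deriv]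
  exact neg_neg_of_pos (div_pos (oscDensity_pos γ hy) hy)

theorem tendsto_oscTail : Tendsto (oscTail γ) atTop (𝓝 0) := by
  set c : ℝ := 1 + ‖(oscCoeff γ : ℂ) * (oscExp γ / (1 - oscExp γ))‖
  have h : Tendsto (fun y : ℝ ↦ c * (√y)⁻¹) atTop (𝓝 0) := by
    simpa using (tendsto_inv_atTop_zero.comp Real.tendsto_sqrt_atTop).const_mul c
  refine squeeze_zero_norm' ?_ h
  filter_upwards [eventually_gt_atTop 0] with y hy
  refine (Complex.abs_re_le_norm _).trans ((norm_add_le _ _).trans ?_)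
  rw [← mul_assoc, norm_mul _ ((y : ℂ) ^ (oscExp γ - 1)), norm_cpow_oscExp_sub_one γ hy,
    ofReal_cpow_half_sub_one hy, Complex.norm_real, Real.norm_of_nonneg (by positivity)]
  simp only [c]
  linarith

theorem exists_oscCount_eq (n : ℕ) : ∃ y : ℝ, 0 < y ∧ oscCount γ y = n + 1 := by
  set m : ℝ := n + 1 with hm
  have hm0 : 0 < m := by positivity
  -- The bracket works because `5/4 · m/2 ≤ m ≤ 3/4 · 2m`.
  have h1 : oscCount γ (m ^ 2 / 4) ≤ m := by
    refine (oscCount_le γ (by positivity)).trans ?_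
    rw [show m ^ 2 / 4 = (m / 2) ^ 2 by ring, Real.sqrt_sq (by positivity)]
    linarith
  have h2 : m ≤ oscCount γ (4 * m ^ 2) := by
    refine le_trans ?_ (le_oscCount γ (by positivity))
    rw [show 4 * m ^ 2 = (2 * m) ^ 2 by ring, Real.sqrt_sq (by positivity)]
    linarith
  have hle : m ^ 2 / 4 ≤ 4 * m ^ 2 := by nlinarith [sq_nonneg m]
  obtain ⟨y, hy, hy'⟩ := intermediate_value_Icc hle
    (fun y hy ↦ (hasDerivAt_oscCount γ
      (lt_of_lt_of_le (by positivity) hy.1)).continuousAt.continuousWithinAt) ⟨h1, h2⟩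
  exact ⟨y, lt_of_lt_of_le (by positivity) hy.1, hy'⟩

/-- The reciprocal lengths: the points where the model counting function takes the values
`1, 2, 3, …`. -/
noncomputable def oscPoint (n : ℕ) : ℝ := (exists_oscCount_eq γ n).choose

theorem oscPoint_pos (n : ℕ) : 0 < oscPoint γ n := (exists_oscCount_eq γ n).choose_spec.1

theorem oscCount_oscPoint (n : ℕ) : oscCount γ (oscPoint γ n) = n + 1 :=
  (exists_oscCount_eq γ n).choose_spec.2

theorem strictMono_oscPoint : StrictMono (oscPoint γ) := fun m n h ↦ by
  rw [← (strictMonoOn_oscCount γ).lt_iff_lt (oscPoint_pos γ m) (oscPoint_pos γ n),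
    oscCount_oscPoint, oscCount_oscPoint]
  exact_mod_cast Nat.succ_lt_succ h

/-- Makes `⌊oscCount γ y⌋₊` the exact number of points up to `y`. The inequality on `n` is strict
because the point of index `n` has value `n + 1`. -/
theorem oscPoint_le_iff {n : ℕ} {y : ℝ} (hy : 0 < y) :
    oscPoint γ n ≤ y ↔ n < ⌊oscCount γ y⌋₊ := by
  rw [← (strictMonoOn_oscCount γ).le_iff_le (oscPoint_pos γ n) hy, oscCount_oscPoint,
    Nat.lt_iff_add_one_le, Nat.le_floor_iff (oscCount_pos γ hy).le]
  push_cast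
  rfl

theorem le_oscPoint (n : ℕ) : ((n : ℝ) + 1) ^ 2 / 4 ≤ oscPoint γ n := by
  have h := oscCount_le γ (oscPoint_pos γ n)
  rw [oscCount_oscPoint] at h
  have h2 := Real.sq_sqrt (oscPoint_pos γ n).le
  have h3 := Real.sqrt_nonneg (oscPoint γ n)
  have h4 : ((n : ℝ) + 1) / 2 ≤ √(oscPoint γ n) := by linarith
  calc ((n : ℝ) + 1) ^ 2 / 4 = (((n : ℝ) + 1) / 2) ^ 2 := by ring
    _ ≤ √(oscPoint γ n) ^ 2 := by gcongr
    _ = _ := h2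

theorem tendsto_oscPoint : Tendsto (oscPoint γ) atTop atTop := by
  refine tendsto_atTop_mono (fun n ↦ (?_ : (n : ℝ) / 4 ≤ _))
    (tendsto_natCast_atTop_atTop.atTop_div_const (by norm_num))
  refine le_trans ?_ (le_oscPoint γ n)
  have : (0 : ℝ) ≤ n := by positivity
  gcongr
  nlinarith

/-- The lengths of the string. -/
noncomputable def oscLength (n : ℕ) : ℝ := (oscPoint γ n)⁻¹

theorem oscLength_pos (n : ℕ) : 0 < oscLength γ n := inv_pos.2 (oscPoint_pos γ n)

theorem summable_oscLength : Summable (oscLength γ) := by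
  have h : Summable fun n : ℕ ↦ 4 * (((n + 1 : ℕ) : ℝ) ^ 2)⁻¹ :=
    (((Real.summable_nat_pow_inv (p := 2)).2 (by norm_num)).comp_injective
      (add_left_injective 1)).mul_left 4
  refine h.of_nonneg_of_le (fun n ↦ (oscLength_pos γ n).le) fun n ↦ ?_
  rw [oscLength]
  refine (inv_anti₀ (by positivity) (le_oscPoint γ n)).trans_eq ?_
  push_cast
  rw [inv_div, div_eq_mul_inv]

/-- By Cauchy's mean value theorem: `oscTail` has derivative `-1/y` times that of `oscCount`, and
`oscCount` rises by exactly `1`, so the difference is `1/c` for an intermediate `c`. -/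
theorem oscTail_sub_mem (n : ℕ) :
    oscTail γ (oscPoint γ n) - oscTail γ (oscPoint γ (n + 1)) ∈
      Set.Icc (oscLength γ (n + 1)) (oscLength γ n) := by
  have hlt := strictMono_oscPoint γ n.lt_succ_self
  have hpos := oscPoint_pos γ n
  obtain ⟨c, hc, hc'⟩ := exists_ratio_hasDerivAt_eq_ratio_slope (oscCount γ) (oscDensity γ) hlt
    (fun y hy ↦ (hasDerivAt_oscCount γ (hpos.trans_le hy.1)).continuousAt.continuousWithinAt)
    (fun y hy ↦ hasDerivAt_oscCount γ (hpos.trans hy.1)) (oscTail γ) (fun y ↦ -(oscDensity γ y / y))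
    (fun y hy ↦ (hasDerivAt_oscTail γ (hpos.trans_le hy.1)).continuousAt.continuousWithinAt)
    (fun y hy ↦ hasDerivAt_oscTail γ (hpos.trans hy.1))
  have hc0 : 0 < c := hpos.trans hc.1
  have hd := oscDensity_pos γ hc0
  rw [oscCount_oscPoint, oscCount_oscPoint] at hc'
  push_cast at hc'
  have : oscTail γ (oscPoint γ n) - oscTail γ (oscPoint γ (n + 1)) = c⁻¹ := by
    have h2 : (oscTail γ (oscPoint γ n) - oscTail γ (oscPoint γ (n + 1))) * oscDensity γ c =
        oscDensity γ c / c := by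
      simp only [Nat.succ_eq_add_one] at hc'
      linarith
    rw [← mul_left_inj' hd.ne', h2]
    field_simp
  rw [this]
  exact ⟨inv_anti₀ hc0 hc.2.le, inv_anti₀ hpos hc.1.le⟩

theorem hasSum_oscTail_sub (J : ℕ) :
    HasSum (fun n ↦ oscTail γ (oscPoint γ (n + J)) - oscTail γ (oscPoint γ (n + J + 1)))
      (oscTail γ (oscPoint γ J)) := by
  refine (hasSum_iff_tendsto_nat_of_nonneg (fun n ↦ ?_) _).2 ?_
  · exact (oscLength_pos γ _).le.trans (oscTail_sub_mem γ (n + J)).1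
  · have h1 : ∀ N : ℕ, ∑ n ∈ Finset.range N,
        (oscTail γ (oscPoint γ (n + J)) - oscTail γ (oscPoint γ (n + J + 1))) =
        oscTail γ (oscPoint γ J) - oscTail γ (oscPoint γ (N + J)) := by
      intro N
      induction N with
      | zero => simp
      | succ N ih => rw [Finset.sum_range_succ, ih, show N + 1 + J = N + J + 1 by ring]; ring
    simp only [h1]
    have h2 := ((tendsto_oscTail γ).comp (tendsto_oscPoint γ)).comp (tendsto_add_atTop_nat J)
    simpa using h2.const_sub (oscTail γ (oscPoint γ J))

/-- The tail `∑_{n ≥ J} ℓ_n`. -/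
noncomputable def oscTailSum (J : ℕ) : ℝ := ∑' n, oscLength γ (n + J)

theorem oscTail_le_oscTailSum (J : ℕ) : oscTail γ (oscPoint γ J) ≤ oscTailSum γ J := by
  rw [← (hasSum_oscTail_sub γ J).tsum_eq]
  exact (hasSum_oscTail_sub γ J).summable.tsum_le_tsum (fun n ↦ (oscTail_sub_mem γ (n + J)).2)
    ((summable_nat_add_iff J).2 (summable_oscLength γ))

theorem oscTailSum_succ_le (J : ℕ) : oscTailSum γ (J + 1) ≤ oscTail γ (oscPoint γ J) := by
  rw [← (hasSum_oscTail_sub γ J).tsum_eq]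
  exact ((summable_nat_add_iff (J + 1)).2 (summable_oscLength γ)).tsum_le_tsum
    (fun n ↦ (oscTail_sub_mem γ (n + J)).1) (hasSum_oscTail_sub γ J).summable

/-- Both quantities are trapped between neighbouring values, so they differ by at most one length.
The index satisfies `n + 1 ≥ √y/2`, so that length is at most `16/y`. -/
theorem abs_oscTailSum_sub_le {y : ℝ} (hy : 16 ≤ y) :
    |oscTailSum γ ⌊oscCount γ y⌋₊ - oscTail γ y| ≤ 16 / y := by
  have hy0 : 0 < y := by linarith
  have hs4 : 4 ≤ √y := Real.le_sqrt_of_sq_le (by linarith)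
  have hJ : √y / 2 ≤ ⌊oscCount γ y⌋₊ := by
    have h1 := Nat.lt_floor_add_one (oscCount γ y)
    have h2 := le_oscCount γ hy0
    linarith
  obtain ⟨n, hn⟩ : ∃ n, ⌊oscCount γ y⌋₊ = n + 1 := by
    refine Nat.exists_eq_succ_of_ne_zero fun h0 ↦ ?_
    rw [h0] at hJ
    norm_num at hJ
    linarith
  have h1 : oscPoint γ n ≤ y := (oscPoint_le_iff γ hy0).2 (by omega)
  have h2 : y ≤ oscPoint γ (n + 1) := by
    have := (oscPoint_le_iff γ (n := n + 1) hy0).not.2 (by omega)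
    linarith
  have h3 := (strictAntiOn_oscTail γ).antitoneOn (oscPoint_pos γ n) hy0 h1
  have h4 := (strictAntiOn_oscTail γ).antitoneOn hy0 (oscPoint_pos γ (n + 1)) h2
  have h5 := oscTailSum_succ_le γ n
  have h6 := oscTail_le_oscTailSum γ (n + 1)
  have h7 := (oscTail_sub_mem γ n).2
  have h8 : oscLength γ n ≤ 16 / y := by
    rw [hn] at hJ
    push_cast at hJ
    have h9 : y / 16 ≤ oscPoint γ n := by
      refine le_trans ?_ (le_oscPoint γ n)
      have := Real.sq_sqrt hy0.le
      have : (√y / 2) ^ 2 ≤ ((n : ℝ) + 1) ^ 2 := by gcongr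
      linarith
    rw [oscLength, ← inv_div]
    exact inv_anti₀ (by positivity) h9
  rw [hn, abs_le]
  constructor <;> linarith

end Osc

/-! ### Asymptotics of the spectral counting function. -/

section Osc

variable (γ : ℝ)

theorem ofReal_div_cpow {x c : ℝ} (hx : 0 < x) (hc : 0 < c) (s : ℂ) :
    ((x / c : ℝ) : ℂ) ^ s = (x : ℂ) ^ s * (c : ℂ) ^ (-s) := by
  rw [div_eq_mul_inv, Complex.ofReal_mul, Complex.mul_cpow_ofReal_nonneg hx.le (by positivity),
    Complex.ofReal_inv, Complex.cpow_neg, Complex.inv_cpow]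
  rw [Complex.arg_ofReal_of_nonneg hc.le]
  exact Real.pi_pos.ne

/-- Zeta enters here. The subtracted constants and the tail term combine through `1 + s/(1-s) =
1/(1-s)` into the regularising term `K^{1-s}/(1-s)`. -/
theorem sum_cpow_sub_eq_zetaPartial {x : ℝ} (hx : 0 < x) {K : ℕ} (hK : 0 < K) {s : ℂ}
    (hs : s ≠ 1) :
    ∑ m ∈ Finset.range K, (((x / ((m : ℝ) + 1) : ℝ) : ℂ) ^ s - ((x / K : ℝ) : ℂ) ^ s) -
      x * (s / (1 - s) * ((x / K : ℝ) : ℂ) ^ (s - 1)) = (x : ℂ) ^ s * zetaPartial s K := by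
  have hK' : (0 : ℝ) < K := by exact_mod_cast hK
  have h1 : 1 - s ≠ 0 := sub_ne_zero.2 hs.symm
  have hKc : (K : ℂ) ≠ 0 := by exact_mod_cast hK.ne'
  have hxc : (x : ℂ) ≠ 0 := by exact_mod_cast hx.ne'
  have h2 : ((x / K : ℝ) : ℂ) ^ (s - 1) = ((x / K : ℝ) : ℂ) ^ s * (K / x) := by
    rw [Complex.cpow_sub _ _ (by exact_mod_cast (div_pos hx hK').ne'), Complex.cpow_one]
    push_cast
    field_simp
  have h3 : (K : ℂ) ^ (1 - s) = K * (K : ℂ) ^ (-s) := by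
    rw [sub_eq_add_neg, Complex.cpow_add _ _ hKc, Complex.cpow_one]
  have h4 : ∀ m : ℕ, ((x / ((m : ℝ) + 1) : ℝ) : ℂ) ^ s = (x : ℂ) ^ s * ((m : ℂ) + 1) ^ (-s) := by
    intro m
    rw [ofReal_div_cpow hx (by positivity)]
    push_cast
    rfl
  rw [h2, Finset.sum_sub_distrib, Finset.sum_const, Finset.card_range, zetaPartial, h3,
    Finset.sum_congr rfl fun m _ ↦ h4 m, ← Finset.mul_sum, ofReal_div_cpow hx hK', nsmul_eq_mul,
    Complex.ofReal_natCast]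
  generalize (K : ℂ) ^ (-s) = A
  generalize (x : ℂ) ^ s = B
  field_simp
  ring

/-- The second-order term of the spectral counting function, truncated at level `K`. -/
noncomputable def oscSecond (x : ℝ) (K : ℕ) : ℝ :=
  ((x : ℂ) ^ (1 / 2 : ℂ) * zetaPartial (1 / 2) K +
    oscCoeff γ * ((x : ℂ) ^ oscExp γ * zetaPartial (oscExp γ) K)).re

theorem sum_oscCount_sub_eq {x : ℝ} (hx : 0 < x) {K : ℕ} (hK : 0 < K) :
    ∑ m ∈ Finset.range K, (oscCount γ (x / ((m : ℝ) + 1)) - oscCount γ (x / K)) -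
      x * oscTail γ (x / K) = oscSecond γ x K := by
  rw [oscSecond, ← sum_cpow_sub_eq_zetaPartial hx hK (by norm_num : (1 / 2 : ℂ) ≠ 1),
    ← sum_cpow_sub_eq_zetaPartial hx hK (oscExp_ne_one γ)]
  simp only [oscCount, oscTail]
  rw [← Complex.re_ofReal_mul]
  simp only [← Complex.sub_re]
  rw [← Complex.re_sum, ← Complex.sub_re]
  congr 1
  rw [mul_sub (oscCoeff γ : ℂ), Finset.mul_sum]
  have : ∑ m ∈ Finset.range K, (((x / ((m : ℝ) + 1) : ℝ) : ℂ) ^ (1 / 2 : ℂ) +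
      oscCoeff γ * ((x / ((m : ℝ) + 1) : ℝ) : ℂ) ^ oscExp γ -
      (((x / K : ℝ) : ℂ) ^ (1 / 2 : ℂ) + oscCoeff γ * ((x / K : ℝ) : ℂ) ^ oscExp γ)) =
      ∑ m ∈ Finset.range K, (((x / ((m : ℝ) + 1) : ℝ) : ℂ) ^ (1 / 2 : ℂ) -
        ((x / K : ℝ) : ℂ) ^ (1 / 2 : ℂ)) +
      ∑ m ∈ Finset.range K, oscCoeff γ * (((x / ((m : ℝ) + 1) : ℝ) : ℂ) ^ oscExp γ -
        ((x / K : ℝ) : ℂ) ^ oscExp γ) := by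
    rw [← Finset.sum_add_distrib]
    exact Finset.sum_congr rfl fun m _ ↦ by ring
  rw [this]
  have : (1 / 2 : ℂ) / (1 - 1 / 2) = 1 := by norm_num
  rw [this]
  ring

/-- The number of pairs `(n, j)` with `n / ℓ_j ≤ x`. -/
noncomputable def oscSpectral (x : ℝ) : ℕ :=
  ∑ j ∈ Finset.range ⌊oscCount γ x⌋₊, ⌊oscLength γ j * x⌋₊

/-- Either side means `(m + 1) · oscPoint γ j ≤ x`; this allows pairs to be counted by multiple or
by length. -/
theorem lt_floor_oscCount_div_iff {x : ℝ} (hx : 0 < x) (m j : ℕ) :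
    j < ⌊oscCount γ (x / ((m : ℝ) + 1))⌋₊ ↔ m < ⌊oscLength γ j * x⌋₊ := by
  have h0 := oscPoint_pos γ j
  rw [← oscPoint_le_iff γ (by positivity), Nat.lt_iff_add_one_le,
    Nat.le_floor_iff (mul_pos (oscLength_pos γ j) hx).le, oscLength, le_div_iff₀ (by positivity),
    ← div_eq_inv_mul, le_div_iff₀ h0]
  push_cast
  rw [mul_comm]

/-- The Dirichlet hyperbola method: a length beyond the first `⌊oscCount γ (x / K)⌋₊` carries fewer
than `K` frequencies up to `x`, so exchanging the sums leaves only `m < K`. -/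
theorem sum_Ico_floor_eq {x : ℝ} (hx : 0 < x) {K : ℕ} (hK : 0 < K) :
    (∑ j ∈ Finset.Ico ⌊oscCount γ (x / K)⌋₊ ⌊oscCount γ x⌋₊, (⌊oscLength γ j * x⌋₊ : ℝ)) =
      ∑ m ∈ Finset.range K,
        ((⌊oscCount γ (x / ((m : ℝ) + 1))⌋₊ : ℝ) - ⌊oscCount γ (x / K)⌋₊) := by
  set J := ⌊oscCount γ (x / K)⌋₊ with hJ
  set M := ⌊oscCount γ x⌋₊ with hM
  have hmono : ∀ {y z : ℝ}, 0 < y → y ≤ z → ⌊oscCount γ y⌋₊ ≤ ⌊oscCount γ z⌋₊ := fun hy hyz ↦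
    Nat.floor_le_floor ((strictMonoOn_oscCount γ).monotoneOn hy (hy.trans_le hyz) hyz)
  have hKr : (0 : ℝ) < K := by exact_mod_cast hK
  have h1 : ∀ j ∈ Finset.Ico J M, ⌊oscLength γ j * x⌋₊ =
      ∑ m ∈ Finset.range K, if j < ⌊oscCount γ (x / ((m : ℝ) + 1))⌋₊ then 1 else 0 := by
    intro j hj
    rw [← Finset.card_filter]
    simp only [lt_floor_oscCount_div_iff γ hx]
    have hle : ⌊oscLength γ j * x⌋₊ ≤ K := by
      by_contra! hlt
      have h2 : K - 1 < ⌊oscLength γ j * x⌋₊ := by omega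
      rw [← lt_floor_oscCount_div_iff γ hx] at h2
      have h3 : ((K - 1 : ℕ) : ℝ) + 1 = K := by
        rw [Nat.cast_sub hK]; push_cast; ring
      rw [h3, ← hJ] at h2
      have := (Finset.mem_Ico.1 hj).1
      omega
    have : (Finset.range K).filter (fun m ↦ m < ⌊oscLength γ j * x⌋₊) =
        Finset.range ⌊oscLength γ j * x⌋₊ := by
      ext m
      simp only [Finset.mem_filter, Finset.mem_range]
      omega
    rw [this, Finset.card_range]
  rw [← Nat.cast_sum, Finset.sum_congr rfl h1, Finset.sum_comm, Nat.cast_sum]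
  refine Finset.sum_congr rfl fun m hm ↦ ?_
  have hm' : (m : ℝ) + 1 ≤ K := by exact_mod_cast Finset.mem_range.1 hm
  have hJm : J ≤ ⌊oscCount γ (x / ((m : ℝ) + 1))⌋₊ :=
    hmono (by positivity) (by gcongr)
  have hmM : ⌊oscCount γ (x / ((m : ℝ) + 1))⌋₊ ≤ M :=
    hmono (by positivity) (div_le_self hx.le (by linarith [(Nat.cast_nonneg m : (0 : ℝ) ≤ m)]))
  rw [← Finset.card_filter]
  have : (Finset.Ico J M).filter (fun j ↦ j < ⌊oscCount γ (x / ((m : ℝ) + 1))⌋₊) =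
      Finset.Ico J ⌊oscCount γ (x / ((m : ℝ) + 1))⌋₊ := by
    ext j
    simp only [Finset.mem_filter, Finset.mem_Ico]
    omega
  rw [this, Nat.card_Ico, Nat.cast_sub hJm]

/-- Removing the floors costs at most `1` for each of the `J` longest intervals, with `J ≤ 5/4
√(x/K)`, and at most `1` for each `m < K`. Replacing the tail of lengths by `oscTail` costs `16 K`.
-/
theorem abs_oscSpectral_sub_le {x : ℝ} {K : ℕ} (hK : 0 < K) (hx : 16 * K ≤ x) :
    |(oscSpectral γ x : ℝ) - (∑' j, oscLength γ j) * x - oscSecond γ x K| ≤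
      5 / 4 * √(x / K) + 17 * K := by
  have hKr : (0 : ℝ) < K := by exact_mod_cast hK
  have hx0 : 0 < x := by linarith
  have hK1 : (1 : ℝ) ≤ K := by exact_mod_cast hK
  set J := ⌊oscCount γ (x / K)⌋₊ with hJ
  set M := ⌊oscCount γ x⌋₊ with hM
  have hJM : J ≤ M := Nat.floor_le_floor ((strictMonoOn_oscCount γ).monotoneOn
    (by simp only [Set.mem_Ioi]; positivity) hx0 (div_le_self hx0.le hK1))
  have h1 : (oscSpectral γ x : ℝ) = ∑ j ∈ Finset.range J, (⌊oscLength γ j * x⌋₊ : ℝ) +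
      ∑ m ∈ Finset.range K, ((⌊oscCount γ (x / ((m : ℝ) + 1))⌋₊ : ℝ) - J) := by
    rw [← sum_Ico_floor_eq γ hx0 hK, oscSpectral, Finset.sum_range_add_sum_Ico _ hJM]
    push_cast
    rfl
  have h2 : (∑' j, oscLength γ j) = ∑ j ∈ Finset.range J, oscLength γ j + oscTailSum γ J :=
    ((summable_oscLength γ).sum_add_tsum_nat_add J).symm
  have h3 := sum_oscCount_sub_eq γ hx0 hK
  have h4 : |∑ j ∈ Finset.range J, ((⌊oscLength γ j * x⌋₊ : ℝ) - oscLength γ j * x)| ≤ J := by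
    refine (Finset.abs_sum_le_sum_abs _ _).trans ?_
    refine (Finset.sum_le_card_nsmul _ _ 1 fun j _ ↦ ?_).trans_eq (by simp)
    have ha := Nat.floor_le (mul_pos (oscLength_pos γ j) hx0).le
    have hb := Nat.lt_floor_add_one (oscLength γ j * x)
    rw [abs_le]
    constructor <;> linarith
  have h5 : |∑ m ∈ Finset.range K, (((⌊oscCount γ (x / ((m : ℝ) + 1))⌋₊ : ℝ) - J) -
      (oscCount γ (x / ((m : ℝ) + 1)) - oscCount γ (x / K)))| ≤ K := by
    refine (Finset.abs_sum_le_sum_abs _ _).trans ?_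
    refine (Finset.sum_le_card_nsmul _ _ 1 fun m _ ↦ ?_).trans_eq (by simp)
    have ha := Nat.floor_le (oscCount_pos γ (show 0 < x / ((m : ℝ) + 1) by positivity)).le
    have hb := Nat.lt_floor_add_one (oscCount γ (x / ((m : ℝ) + 1)))
    have hc := Nat.floor_le (oscCount_pos γ (show 0 < x / (K : ℝ) by positivity)).le
    have hd := Nat.lt_floor_add_one (oscCount γ (x / K))
    rw [abs_le]
    constructor <;> linarith
  have h6 : |x * (oscTailSum γ J - oscTail γ (x / K))| ≤ 16 * K := by
    rw [abs_mul, abs_of_pos hx0]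
    calc _ ≤ x * (16 / (x / K)) := by
          gcongr
          exact abs_oscTailSum_sub_le γ ((le_div_iff₀ hKr).2 hx)
      _ = 16 * K := by field_simp
  have h7 : (J : ℝ) ≤ 5 / 4 * √(x / K) :=
    (Nat.floor_le (oscCount_pos γ (by positivity)).le).trans (oscCount_le γ (by positivity))
  rw [Finset.sum_sub_distrib] at h4 h5
  rw [← Finset.sum_mul] at h4
  rw [h1, h2, ← h3]
  rw [abs_le] at h4 h5 h6 ⊢
  constructor <;> linarith [h4.1, h4.2, h5.1, h5.2, h6.1, h6.2]

theorem abs_oscSecond_sub_le {x : ℝ} (hx : 0 < x) (K : ℕ) :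
    |oscSecond γ x K - (riemannZeta (1 / 2)).re * √x| ≤
      √x * (‖zetaPartial (1 / 2) K - riemannZeta (1 / 2)‖ + ‖zetaPartial (oscExp γ) K‖) := by
  have h1 : (riemannZeta (1 / 2)).re * √x = ((x : ℂ) ^ (1 / 2 : ℂ) * riemannZeta (1 / 2)).re := by
    rw [ofReal_cpow_half hx, Complex.re_ofReal_mul, mul_comm]
  rw [h1, oscSecond, ← Complex.sub_re]
  refine (Complex.abs_re_le_norm _).trans ?_
  rw [add_sub_right_comm, ← mul_sub]
  refine (norm_add_le _ _).trans ?_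
  rw [norm_mul, norm_mul, norm_mul, norm_cpow_oscExp γ hx, ofReal_cpow_half hx, Complex.norm_real,
    Complex.norm_real, Real.norm_of_nonneg (Real.sqrt_nonneg _),
    Real.norm_of_nonneg (oscCoeff_pos γ).le, mul_add]
  have h2 := oscCoeff_le γ
  have h3 : 0 ≤ √x * ‖zetaPartial (oscExp γ) K‖ := by positivity
  nlinarith

theorem isLittleO_oscSpectral (hγ : riemannZeta (oscExp γ) = 0) :
    (fun x : ℝ ↦ (oscSpectral γ x : ℝ) -
      ((∑' j, oscLength γ j) * x - (-(riemannZeta (1 / 2)).re) * x ^ (1 / 2 : ℝ)))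
      =o[atTop] (fun x : ℝ ↦ x ^ (1 / 2 : ℝ)) := by
  refine isLittleO_iff.2 fun ε hε ↦ ?_
  have t1 : Tendsto (fun K : ℕ ↦ 5 / 4 * (√(K : ℝ))⁻¹) atTop (𝓝 0) := by
    simpa using (tendsto_inv_atTop_zero.comp
      (Real.tendsto_sqrt_atTop.comp tendsto_natCast_atTop_atTop)).const_mul (5 / 4 : ℝ)
  have t2 : Tendsto (fun K : ℕ ↦ ‖zetaPartial (1 / 2) K - riemannZeta (1 / 2)‖) atTop (𝓝 0) := by
    simpa using ((tendsto_zetaPartial (s := 1 / 2) (by norm_num) (by norm_num)).sub_const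
      (riemannZeta (1 / 2))).norm
  have t3 : Tendsto (fun K : ℕ ↦ ‖zetaPartial (oscExp γ) K‖) atTop (𝓝 0) := by
    have := (tendsto_zetaPartial (s := oscExp γ) (by simp) (oscExp_ne_one γ)).norm
    rwa [hγ, norm_zero] at this
  have hε4 : 0 < ε / 4 := by positivity
  -- `K` is fixed before `x` grows. Three quarters of `ε` are spent on terms small in `K`, the last
  -- on `17 K ≤ (ε/4) √x`.
  obtain ⟨K, hK0, hK1, hK2, hK3⟩ := ((eventually_gt_atTop 0).and ((t1.eventually_lt_const hε4).and
    ((t2.eventually_lt_const hε4).and (t3.eventually_lt_const hε4)))).exists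
  filter_upwards [eventually_ge_atTop (16 * (K : ℝ)), Real.tendsto_sqrt_atTop.eventually_ge_atTop
    (17 * K / (ε / 4))] with x hx hx2
  have hKr : (0 : ℝ) < K := by exact_mod_cast hK0
  have hx0 : 0 < x := by linarith
  have h1 := abs_oscSpectral_sub_le γ hK0 hx
  have h2 := abs_oscSecond_sub_le γ hx0 K
  rw [div_le_iff₀ hε4] at hx2
  rw [Real.sqrt_div hx0.le] at h1
  rw [← Real.sqrt_eq_rpow, Real.norm_of_nonneg (Real.sqrt_nonneg _), Real.norm_eq_abs]
  have hs := Real.sqrt_pos.2 hx0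
  have h3 : 5 / 4 * (√x / √(K : ℝ)) ≤ ε / 4 * √x := by
    calc _ = 5 / 4 * (√(K : ℝ))⁻¹ * √x := by ring
      _ ≤ _ := by gcongr
  have h4 : √x * (‖zetaPartial (1 / 2) K - riemannZeta (1 / 2)‖ + ‖zetaPartial (oscExp γ) K‖) ≤
      √x * (ε / 4 + ε / 4) := by gcongr
  rw [abs_le] at h1 h2 ⊢
  constructor <;> linarith [h1.1, h1.2, h2.1, h2.2]

/-! ### The oscillating tube volume. -/

/-- The volume of the inner tube of radius `1 / (2y)`. -/
noncomputable def oscTube (y : ℝ) : ℝ := ∑' j, min y⁻¹ (oscLength γ j)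

theorem oscTube_eq {y : ℝ} (hy : 0 < y) :
    oscTube γ y = ⌊oscCount γ y⌋₊ * y⁻¹ + oscTailSum γ ⌊oscCount γ y⌋₊ := by
  set J := ⌊oscCount γ y⌋₊ with hJ
  have hs : Summable fun j ↦ min y⁻¹ (oscLength γ j) :=
    (summable_oscLength γ).of_nonneg_of_le
      (fun j ↦ le_min (inv_pos.2 hy).le (oscLength_pos γ j).le) fun j ↦ min_le_right _ _
  rw [oscTube, ← hs.sum_add_tsum_nat_add J, oscTailSum]
  congr 1
  · rw [Finset.sum_congr rfl (g := fun _ ↦ y⁻¹), Finset.sum_const, Finset.card_range, nsmul_eq_mul]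
    intro j hj
    exact min_eq_left (inv_anti₀ (oscPoint_pos γ j)
      ((oscPoint_le_iff γ hy).2 (Finset.mem_range.1 hj)))
  · refine tsum_congr fun j ↦ min_eq_right ?_
    have := (oscPoint_le_iff γ (n := j + J) hy).not.2 (by omega)
    exact inv_anti₀ hy (by linarith)

/-- The oscillating factor of the tube volume. -/
noncomputable def oscWave (y : ℝ) : ℝ :=
  2 + oscCoeff γ * ((y : ℂ) ^ (γ * Complex.I) / (1 - oscExp γ)).re

theorem abs_oscTube_sub_le {y : ℝ} (hy : 16 ≤ y) :
    |√y * oscTube γ y - oscWave γ y| ≤ 17 / √y := by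
  have hy0 : 0 < y := by linarith
  have hs := Real.sqrt_pos.2 hy0
  have hyc : (y : ℂ) ≠ 0 := by exact_mod_cast hy0.ne'
  have hsq : √y * √y = y := Real.mul_self_sqrt hy0.le
  have h1 : oscWave γ y = √y * (oscCount γ y * y⁻¹ + oscTail γ y) := by
    have hsc : ((√y : ℝ) : ℂ) ≠ 0 := by exact_mod_cast hs.ne'
    have hsqc : ((√y : ℝ) : ℂ) * (√y : ℝ) = y := by exact_mod_cast hsq
    have e1 : (y : ℂ) ^ oscExp γ = (√y : ℝ) * (y : ℂ) ^ (γ * Complex.I) := by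
      rw [oscExp, Complex.cpow_add _ _ hyc, ofReal_cpow_half hy0]
    have e2 : (y : ℂ) ^ (oscExp γ - 1) = (√y : ℝ) * (y : ℂ) ^ (γ * Complex.I) / y := by
      rw [Complex.cpow_sub _ _ hyc, Complex.cpow_one, e1]
    have h2 := one_sub_oscExp_ne_zero γ
    have e3 : ((y⁻¹ : ℝ) : ℂ) = (y : ℂ)⁻¹ := Complex.ofReal_inv y
    rw [oscWave, oscCount, oscTail, ← Complex.re_mul_ofReal, ← Complex.add_re,
      ← Complex.re_ofReal_mul, ← Complex.re_ofReal_mul, e1, e2, ofReal_cpow_half hy0,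
      ofReal_cpow_half_sub_one hy0, e3, show (2 : ℝ) = (2 : ℂ).re from rfl, ← Complex.add_re]
    congr 1
    push_cast
    rw [← hsqc]
    generalize (y : ℂ) ^ (γ * Complex.I) = A
    field_simp
    ring
  have h3 := abs_oscTailSum_sub_le γ hy
  have ha := Nat.floor_le (oscCount_pos γ hy0).le
  have hb := Nat.lt_floor_add_one (oscCount γ y)
  have h4 : |(⌊oscCount γ y⌋₊ * y⁻¹ : ℝ) - oscCount γ y * y⁻¹| ≤ y⁻¹ := by
    rw [← sub_mul, abs_mul, abs_of_pos (inv_pos.2 hy0)]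
    refine mul_le_of_le_one_left (inv_pos.2 hy0).le ?_
    rw [abs_le]
    constructor <;> linarith
  rw [h1, ← mul_sub, abs_mul, abs_of_pos hs, oscTube_eq γ hy0]
  calc _ ≤ √y * (17 / y) := by
        gcongr
        have : 17 / y = y⁻¹ + 16 / y := by field_simp; norm_num
        rw [this]
        rw [abs_le] at h3 h4 ⊢
        constructor <;> linarith [h3.1, h3.2, h4.1, h4.2]
    _ = 17 / √y := by
        rw [mul_div_assoc', div_eq_div_iff hy0.ne' hs.ne']
        linear_combination 17 * hsq

theorem abs_oscWave_sub_two_le {y : ℝ} (hy : 0 < y) : |oscWave γ y - 2| ≤ 1 / 2 := by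
  rw [oscWave, add_sub_cancel_left, abs_mul, abs_of_pos (oscCoeff_pos γ)]
  have h1 : ‖(y : ℂ) ^ (γ * Complex.I)‖ = 1 := by
    rw [Complex.norm_cpow_eq_rpow_re_of_pos hy]; simp
  have h2 : 1 / 2 ≤ ‖1 - oscExp γ‖ := by
    refine le_trans ?_ (Complex.abs_re_le_norm _)
    rw [Complex.sub_re, oscExp_re]
    norm_num
  have h3 : |((y : ℂ) ^ (γ * Complex.I) / (1 - oscExp γ)).re| ≤ 2 := by
    refine (Complex.abs_re_le_norm _).trans ?_
    rw [norm_div, h1]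
    calc 1 / ‖1 - oscExp γ‖ ≤ 1 / (1 / 2) := by gcongr
      _ = 2 := by norm_num
  exact (mul_le_mul (oscCoeff_le γ) h3 (abs_nonneg _) (by norm_num)).trans_eq (by norm_num)

theorem oscWave_exp (t : ℝ) :
    oscWave γ (Real.exp t) =
      2 + oscCoeff γ * (Complex.exp (γ * t * Complex.I) / (1 - oscExp γ)).re := by
  rw [oscWave, Complex.cpow_def_of_ne_zero (by exact_mod_cast (Real.exp_pos _).ne'),
    ← Complex.ofReal_log (Real.exp_pos _).le, Real.log_exp]
  congr 5
  ring

theorem re_inv_one_sub_oscExp_pos : 0 < ((1 : ℂ) / (1 - oscExp γ)).re := by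
  rw [one_div, Complex.inv_re, Complex.sub_re, oscExp_re]
  have := Complex.normSq_pos.2 (one_sub_oscExp_ne_zero γ)
  have : (0 : ℝ) < (1 : ℂ).re - 1 / 2 := by norm_num
  positivity

/-- The rescaled tube volume has no limit. -/
theorem not_tendsto_oscTube (hγ : γ ≠ 0) (L : ℝ) :
    ¬ Tendsto (fun y ↦ √y * oscTube γ y) atTop (𝓝 L) := by
  intro h
  have hw : Tendsto (oscWave γ) atTop (𝓝 L) := by
    have h0 : Tendsto (fun y ↦ √y * oscTube γ y - oscWave γ y) atTop (𝓝 0) := by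
      have h1 : Tendsto (fun y : ℝ ↦ 17 / √y) atTop (𝓝 0) :=
        Real.tendsto_sqrt_atTop.const_div_atTop 17
      refine squeeze_zero_norm' ?_ h1
      filter_upwards [eventually_ge_atTop 16] with y hy using abs_oscTube_sub_le γ hy
    simpa using h.sub h0
  -- Sampling where `|γ| log y = 2πn + c`. The phases `c = 0` and `c = π` give the limits `2 ± β Re
  -- (1/(1 - ρ))`, which differ.
  have htop : ∀ c : ℝ, Tendsto (fun n : ℕ ↦ Real.exp (((n : ℝ) * (2 * Real.pi) + c) / |γ|))
      atTop atTop := fun c ↦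
    Real.tendsto_exp_atTop.comp ((tendsto_atTop_add_const_right _ _
      (tendsto_natCast_atTop_atTop.atTop_mul_const Real.two_pi_pos)).atTop_div_const (abs_pos.2 hγ))
  have hγc : (γ : ℂ) ≠ 0 := by exact_mod_cast hγ
  -- The symmetry required of `c` makes the sign of `γ` irrelevant.
  have hexp : ∀ (c : ℝ) (n : ℕ), Complex.exp (c * Complex.I) = Complex.exp (-(c * Complex.I)) →
      Complex.exp (γ * (((n : ℝ) * (2 * Real.pi) + c) / |γ| : ℝ) * Complex.I) =
        Complex.exp (c * Complex.I) := by
    intro c n hc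
    have h2 := Complex.exp_nat_mul_two_pi_mul_I n
    rcases abs_choice γ with hg | hg
    · have e : (γ * (((n : ℝ) * (2 * Real.pi) + c) / |γ| : ℝ) * Complex.I : ℂ) =
          n * (2 * Real.pi * Complex.I) + c * Complex.I := by
        rw [hg]
        push_cast
        field_simp
      rw [e, Complex.exp_add, h2, one_mul]
    · have e : (γ * (((n : ℝ) * (2 * Real.pi) + c) / |γ| : ℝ) * Complex.I : ℂ) =
          -(n * (2 * Real.pi * Complex.I)) + -(c * Complex.I) := by
        rw [hg]
        push_cast
        field_simp
        ring
      rw [e, Complex.exp_add, Complex.exp_neg, h2, inv_one, one_mul, hc]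
  have hlim : ∀ c : ℝ, Complex.exp (c * Complex.I) = Complex.exp (-(c * Complex.I)) →
      L = 2 + oscCoeff γ * (Complex.exp (c * Complex.I) / (1 - oscExp γ)).re := by
    intro c hc
    refine tendsto_nhds_unique (hw.comp (htop c)) ?_
    refine tendsto_const_nhds.congr fun n ↦ ?_
    rw [Function.comp_apply, oscWave_exp, hexp c n hc]
  have l0 := hlim 0 (by simp)
  have l1 := hlim Real.pi (by rw [Complex.exp_neg, Complex.exp_pi_mul_I]; norm_num)
  rw [Complex.exp_pi_mul_I, neg_div, Complex.neg_re] at l1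
  simp only [Complex.ofReal_zero, zero_mul, Complex.exp_zero] at l0
  have := mul_pos (oscCoeff_pos γ) (re_inv_one_sub_oscExp_pos γ)
  linarith

end Osc

/-! ### A fractal string with prescribed lengths. -/

/-- The tail `∑_{i ≥ n} ℓ_i`. -/
noncomputable def tailSum (ℓ : ℕ → ℝ) (n : ℕ) : ℝ := ∑' i, ℓ (i + n)

/-- The `n`-th of the consecutive intervals with lengths `ℓ_n`, accumulating at `0`. -/
def stringInterval (ℓ : ℕ → ℝ) (n : ℕ) : Set ℝ := Set.Ioo (tailSum ℓ (n + 1)) (tailSum ℓ n)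

section Intervals

variable {ℓ : ℕ → ℝ} (hpos : ∀ n, 0 < ℓ n) (hsum : Summable ℓ)

include hsum in
theorem tailSum_eq_add (n : ℕ) : tailSum ℓ n = ℓ n + tailSum ℓ (n + 1) := by
  rw [tailSum, ((summable_nat_add_iff n).2 hsum).tsum_eq_zero_add, zero_add, tailSum]
  congr 2
  ext i
  congr 1
  ring

include hpos hsum

theorem strictAnti_tailSum : StrictAnti (tailSum ℓ) :=
  strictAnti_nat_of_succ_lt fun n ↦ by
    rw [tailSum_eq_add hsum n]
    linarith [hpos n]

theorem tailSum_pos (n : ℕ) : 0 < tailSum ℓ n :=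
  ((summable_nat_add_iff n).2 hsum).tsum_pos (fun _ ↦ (hpos _).le) 0 (hpos _)

theorem tailSum_notMem_stringInterval (n k : ℕ) : tailSum ℓ n ∉ stringInterval ℓ k := by
  intro h
  have h1 := (strictAnti_tailSum hpos hsum).lt_iff_gt.1 h.1
  have h2 := (strictAnti_tailSum hpos hsum).lt_iff_gt.1 h.2
  omega

theorem pairwise_disjoint_stringInterval : Pairwise (Function.onFun Disjoint (stringInterval ℓ)) := by
  have key : ∀ m n, m < n → Disjoint (stringInterval ℓ m) (stringInterval ℓ n) := by
    intro m n hmn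
    rw [Set.disjoint_left]
    intro x hx hx'
    have := (strictAnti_tailSum hpos hsum).antitone (Nat.succ_le_of_lt hmn)
    linarith [hx.1, hx'.2, this]
  intro m n hmn
  rcases lt_or_gt_of_ne hmn with h | h
  · exact key m n h
  · exact (key n m h).symm

theorem midpoint_mem_stringInterval (n : ℕ) :
    (tailSum ℓ (n + 1) + tailSum ℓ n) / 2 ∈ stringInterval ℓ n := by
  have := strictAnti_tailSum hpos hsum n.lt_succ_self
  constructor <;> simp only [Nat.succ_eq_add_one] at this <;> linarith

/-- An order-connected subset of the string lies in a single interval. -/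
theorem subset_stringInterval {s : Set ℝ} (hs : s.OrdConnected) (hsub : s ⊆ ⋃ n, stringInterval ℓ n)
    {x : ℝ} {n : ℕ} (hx : x ∈ s) (hxn : x ∈ stringInterval ℓ n) : s ⊆ stringInterval ℓ n := by
  intro y hy
  have hout : ∀ k, tailSum ℓ k ∉ s := fun k hk ↦ by
    obtain ⟨m, hm⟩ := Set.mem_iUnion.1 (hsub hk)
    exact tailSum_notMem_stringInterval hpos hsum k m hm
  constructor
  · by_contra! h
    exact hout (n + 1) (hs.out hy hx ⟨h, hxn.1.le⟩)
  · by_contra! h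
    exact hout n (hs.out hx hy ⟨hxn.2.le, h⟩)

theorem iUnion_stringInterval_subset : ⋃ n, stringInterval ℓ n ⊆ Set.Icc 0 (tailSum ℓ 0) := by
  refine Set.iUnion_subset fun n x hx ↦ ⟨?_, ?_⟩
  · exact ((tailSum_pos hpos hsum (n + 1)).trans hx.1).le
  · exact hx.2.le.trans ((strictAnti_tailSum hpos hsum).antitone (Nat.zero_le n))

/-- The fractal string with prescribed lengths. -/
def stringOfLengths : FractalString where
  carrier := ⋃ n, stringInterval ℓ n
  isOpen_carrier := isOpen_iUnion fun _ ↦ isOpen_Ioo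
  isBounded_carrier := (Metric.isBounded_Icc _ _).subset (iUnion_stringInterval_subset hpos hsum)
  not_finite_union := by
    intro S hS hI hU
    have hmem : ∀ n, ∃ s ∈ S, (tailSum ℓ (n + 1) + tailSum ℓ n) / 2 ∈ s := fun n ↦ by
      have : (tailSum ℓ (n + 1) + tailSum ℓ n) / 2 ∈ ⋃₀ S := by
        rw [hU]
        exact Set.mem_iUnion.2 ⟨n, midpoint_mem_stringInterval hpos hsum n⟩
      exact this
    choose f hfS hf using hmem
    -- Pigeonhole: two midpoints fall in one member of `S`, which cannot leave a single interval of
    -- the string.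
    have := hS.to_subtype
    obtain ⟨m, n, hmn, hfmn⟩ := Finite.exists_ne_map_eq_of_infinite
      (fun n ↦ (⟨f n, hfS n⟩ : S))
    have hfe : f m = f n := congrArg Subtype.val hfmn
    have hsub : f m ⊆ stringInterval ℓ m := subset_stringInterval hpos hsum (hI _ (hfS m))
      (hU ▸ Set.subset_sUnion_of_mem (hfS m)) (hf m) (midpoint_mem_stringInterval hpos hsum m)
    exact Set.disjoint_left.1 (pairwise_disjoint_stringInterval hpos hsum hmn) (hsub (hfe ▸ hf n))
      (midpoint_mem_stringInterval hpos hsum n)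

theorem stringOfLengths_carrier :
    (stringOfLengths hpos hsum).carrier = ⋃ n, stringInterval ℓ n := rfl

theorem connectedComponentIn_stringOfLengths {x : ℝ} {n : ℕ} (hx : x ∈ stringInterval ℓ n) :
    connectedComponentIn (stringOfLengths hpos hsum).carrier x = stringInterval ℓ n := by
  have hxU : x ∈ (stringOfLengths hpos hsum).carrier := Set.mem_iUnion.2 ⟨n, hx⟩
  refine Set.Subset.antisymm ?_ ?_
  · exact subset_stringInterval hpos hsum isPreconnected_connectedComponentIn.ordConnected
      (connectedComponentIn_subset _ _) (mem_connectedComponentIn hxU) hx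
  · exact isPreconnected_Ioo.subset_connectedComponentIn hx
      (Set.subset_iUnion (stringInterval ℓ) n)

theorem components_stringOfLengths :
    (stringOfLengths hpos hsum).components = Set.range (stringInterval ℓ) := by
  ext I
  constructor
  · rintro ⟨x, hx, rfl⟩
    obtain ⟨n, hn⟩ := Set.mem_iUnion.1 hx
    exact ⟨n, (connectedComponentIn_stringOfLengths hpos hsum hn).symm⟩
  · rintro ⟨n, rfl⟩
    have h := midpoint_mem_stringInterval hpos hsum n
    exact ⟨_, Set.mem_iUnion.2 ⟨n, h⟩, (connectedComponentIn_stringOfLengths hpos hsum h).symm⟩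

theorem injective_stringInterval : Function.Injective (stringInterval ℓ) := by
  intro m n h
  by_contra hmn
  have h1 := midpoint_mem_stringInterval hpos hsum m
  exact Set.disjoint_left.1 (pairwise_disjoint_stringInterval hpos hsum hmn) h1 (h ▸ h1)

omit hpos in
theorem volume_stringInterval (n : ℕ) : volume (stringInterval ℓ n) = ENNReal.ofReal (ℓ n) := by
  rw [stringInterval, Real.volume_Ioo, tailSum_eq_add hsum n, add_sub_cancel_right]

theorem volume_real_stringInterval (n : ℕ) : volume.real (stringInterval ℓ n) = ℓ n := by
  rw [Measure.real, volume_stringInterval hsum, ENNReal.toReal_ofReal (hpos n).le]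

theorem volume_real_stringOfLengths :
    volume.real (stringOfLengths hpos hsum).carrier = ∑' n, ℓ n := by
  rw [stringOfLengths_carrier, Measure.real, measure_iUnion (pairwise_disjoint_stringInterval hpos hsum)
    fun _ ↦ measurableSet_Ioo]
  simp only [volume_stringInterval hsum]
  rw [← ENNReal.ofReal_tsum_of_nonneg (fun n ↦ (hpos n).le) hsum,
    ENNReal.toReal_ofReal (tsum_nonneg fun n ↦ (hpos n).le)]

/-- Intervals of index at least `M` carry no frequency up to `x`, and the interval of index `n`
carries `⌊ℓ n * x⌋₊` of them. -/
theorem spectralCounting_stringOfLengths {x : ℝ} (hx : 0 < x) {M : ℕ}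
    (hM : ∀ n, M ≤ n → ℓ n * x < 1) :
    (stringOfLengths hpos hsum).spectralCounting x = ∑ n ∈ Finset.range M, ⌊ℓ n * x⌋₊ := by
  set A : Finset (Σ _ : ℕ, ℕ) := (Finset.range M).sigma fun j ↦ Finset.Icc 1 ⌊ℓ j * x⌋₊ with hA
  have hset : (stringOfLengths hpos hsum).frequencyIndices x =
      (fun p : Σ _ : ℕ, ℕ ↦ (p.2, stringInterval ℓ p.1)) '' (A : Set (Σ _ : ℕ, ℕ)) := by
    ext ⟨n, I⟩
    simp only [FractalString.frequencyIndices, components_stringOfLengths, Set.mem_ofPred_eq,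
      Set.mem_range, Set.mem_image, Finset.mem_coe, hA, Finset.mem_sigma, Finset.mem_range,
      Finset.mem_Icc, Prod.mk.injEq]
    have hiff : ∀ j, (n : ℝ) * (volume.real (stringInterval ℓ j))⁻¹ ≤ x ↔ n ≤ ⌊ℓ j * x⌋₊ := by
      intro j
      rw [volume_real_stringInterval hpos hsum, Nat.le_floor_iff (mul_pos (hpos j) hx).le,
        ← div_eq_mul_inv, div_le_iff₀ (hpos j), mul_comm x]
    constructor
    · rintro ⟨h1, ⟨j, rfl⟩, h3⟩
      rw [hiff] at h3
      refine ⟨⟨j, n⟩, ⟨?_, h1, h3⟩, rfl, rfl⟩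
      by_contra! hj
      have := Nat.floor_eq_zero.2 (hM j hj)
      omega
    · rintro ⟨⟨j, m⟩, ⟨_, h2, h3⟩, rfl, rfl⟩
      exact ⟨h2, ⟨j, rfl⟩, (hiff j).2 h3⟩
  have hinj : Function.Injective fun p : Σ _ : ℕ, ℕ ↦ (p.2, stringInterval ℓ p.1) := by
    rintro ⟨j, n⟩ ⟨k, m⟩ h
    simp only [Prod.mk.injEq] at h
    obtain ⟨rfl, h⟩ := h
    rw [injective_stringInterval hpos hsum h]
  rw [FractalString.spectralCounting, hset, Set.ncard_image_of_injective _ hinj,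
    Set.ncard_coe_finset, hA, Finset.card_sigma]
  simp

theorem tailSum_mem_frontier (n : ℕ) (hn : tailSum ℓ n ∈ closure (stringOfLengths hpos hsum).carrier) :
    tailSum ℓ n ∈ frontier (stringOfLengths hpos hsum).carrier := by
  rw [(stringOfLengths hpos hsum).isOpen_carrier.frontier_eq]
  refine ⟨hn, fun h ↦ ?_⟩
  obtain ⟨m, hm⟩ := Set.mem_iUnion.1 h
  exact tailSum_notMem_stringInterval hpos hsum n m hm

/-- Both endpoints are boundary points and no boundary point lies inside the interval, so the
nearest one is an endpoint. -/
theorem infDist_frontier_lt_iff {x ε : ℝ} {n : ℕ} (hx : x ∈ stringInterval ℓ n) :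
    Metric.infDist x (frontier (stringOfLengths hpos hsum).carrier) < ε ↔
      x - tailSum ℓ (n + 1) < ε ∨ tailSum ℓ n - x < ε := by
  have hlt := strictAnti_tailSum hpos hsum n.lt_succ_self
  have hcl : closure (stringInterval ℓ n) ⊆ closure (stringOfLengths hpos hsum).carrier :=
    closure_mono (Set.subset_iUnion (stringInterval ℓ) n)
  rw [stringInterval, closure_Ioo hlt.ne] at hcl
  have h1 : tailSum ℓ (n + 1) ∈ frontier (stringOfLengths hpos hsum).carrier :=
    tailSum_mem_frontier hpos hsum _ (hcl (Set.left_mem_Icc.2 hlt.le))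
  have h2 : tailSum ℓ n ∈ frontier (stringOfLengths hpos hsum).carrier :=
    tailSum_mem_frontier hpos hsum _ (hcl (Set.right_mem_Icc.2 hlt.le))
  rw [Metric.infDist_lt_iff ⟨_, h1⟩]
  constructor
  · rintro ⟨z, hz, hxz⟩
    have hzn : z ∉ stringInterval ℓ n := fun h ↦ by
      rw [(stringOfLengths hpos hsum).isOpen_carrier.frontier_eq] at hz
      exact hz.2 (Set.mem_iUnion.2 ⟨n, h⟩)
    rw [Real.dist_eq] at hxz
    have ha := abs_lt.1 hxz
    by_cases hz1 : z ≤ tailSum ℓ (n + 1)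
    · left; linarith [ha.2]
    · right
      have : tailSum ℓ n ≤ z := by
        by_contra! h
        exact hzn ⟨not_le.1 hz1, h⟩
      linarith [ha.1]
  · rintro (h | h)
    · refine ⟨_, h1, ?_⟩
      rwa [Real.dist_eq, abs_of_pos (by linarith [hx.1])]
    · refine ⟨_, h2, ?_⟩
      rwa [Real.dist_eq, abs_sub_comm, abs_of_pos (by linarith [hx.2])]

omit hpos hsum in
theorem volume_Ioo_collar {c d ε : ℝ} (hε : 0 < ε) :
    volume {x ∈ Set.Ioo c d | x - c < ε ∨ d - x < ε} = ENNReal.ofReal (min (2 * ε) (d - c)) := by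
  rcases lt_or_ge (d - c) (2 * ε) with h | h
  · have : {x ∈ Set.Ioo c d | x - c < ε ∨ d - x < ε} = Set.Ioo c d := by
      ext x
      simp only [Set.mem_ofPred_eq, and_iff_left_iff_imp]
      intro _
      by_contra! h'
      linarith [h'.1, h'.2]
    rw [this, Real.volume_Ioo, min_eq_right h.le]
  · have : {x ∈ Set.Ioo c d | x - c < ε ∨ d - x < ε} = Set.Ioo c (c + ε) ∪ Set.Ioo (d - ε) d := by
      ext x
      simp only [Set.mem_ofPred_eq, Set.mem_Ioo, Set.mem_union]
      constructor
      · rintro ⟨⟨h1, h2⟩, h3 | h3⟩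
        · left; constructor <;> linarith
        · right; constructor <;> linarith
      · rintro (⟨h1, h2⟩ | ⟨h1, h2⟩)
        · exact ⟨⟨h1, by linarith⟩, Or.inl (by linarith)⟩
        · exact ⟨⟨by linarith, h2⟩, Or.inr (by linarith)⟩
    rw [this, measure_union ?_ measurableSet_Ioo, Real.volume_Ioo, Real.volume_Ioo,
      ← ENNReal.ofReal_add (by linarith) (by linarith), min_eq_left h]
    · congr 1; ring
    · rw [Set.disjoint_left]
      intro x hx hx'
      linarith [hx.2, hx'.1]

theorem volume_innerTube_stringOfLengths {ε : ℝ} (hε : 0 < ε) :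
    volume ((stringOfLengths hpos hsum).innerTube ε) =
      ENNReal.ofReal (∑' n, min (2 * ε) (ℓ n)) := by
  set T : ℕ → Set ℝ := fun n ↦ {x ∈ Set.Ioo (tailSum ℓ (n + 1)) (tailSum ℓ n) |
    x - tailSum ℓ (n + 1) < ε ∨ tailSum ℓ n - x < ε} with hT
  have hset : (stringOfLengths hpos hsum).innerTube ε = ⋃ n, T n := by
    ext x
    simp only [FractalString.innerTube, Set.mem_ofPred_eq, Set.mem_iUnion, hT]
    constructor
    · rintro ⟨hx, h⟩
      obtain ⟨n, hn⟩ := Set.mem_iUnion.1 hx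
      exact ⟨n, hn, (infDist_frontier_lt_iff hpos hsum hn).1 h⟩
    · rintro ⟨n, hn, h⟩
      exact ⟨Set.mem_iUnion.2 ⟨n, hn⟩, (infDist_frontier_lt_iff hpos hsum hn).2 h⟩
  have hTsub : ∀ n, T n ⊆ stringInterval ℓ n := fun n x hx ↦ hx.1
  have hmeas : ∀ n, MeasurableSet (T n) := fun n ↦
    measurableSet_Ioo.inter ((measurableSet_lt (measurable_id.sub_const _) measurable_const).union
      (measurableSet_lt (measurable_id.const_sub _) measurable_const))
  have hvol : ∀ n, volume (T n) = ENNReal.ofReal (min (2 * ε) (ℓ n)) := fun n ↦ by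
    rw [hT, volume_Ioo_collar hε,
      tailSum_eq_add hsum n, add_sub_cancel_right]
  have hnn : ∀ n, 0 ≤ min (2 * ε) (ℓ n) := fun n ↦ le_min (by positivity) (hpos n).le
  rw [hset, measure_iUnion (fun m n hmn ↦ (pairwise_disjoint_stringInterval hpos hsum hmn).mono
    (hTsub m) (hTsub n)) hmeas]
  simp only [hvol]
  exact (ENNReal.ofReal_tsum_of_nonneg hnn
    (hsum.of_nonneg_of_le hnn fun n ↦ min_le_right _ _)).symm

end Intervals

/-! ### The counterexample: its spectrum, dimension and lack of measurability. -/

section Osc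

variable (γ : ℝ)

/-- The oscillating fractal string, of dimension `1/2`. -/
noncomputable def oscString : FractalString :=
  stringOfLengths (oscLength_pos γ) (summable_oscLength γ)

theorem spectralCounting_oscString {x : ℝ} (hx : 0 < x) :
    (oscString γ).spectralCounting x = oscSpectral γ x := by
  refine spectralCounting_stringOfLengths (oscLength_pos γ) (summable_oscLength γ) hx fun n hn ↦ ?_
  have h := (oscPoint_le_iff γ (n := n) hx).not.2 (by omega)
  rw [oscLength, ← div_eq_inv_mul, div_lt_one (oscPoint_pos γ n)]
  exact not_le.1 h

theorem hasMonotonicSecondTerm_oscString (hγ : riemannZeta (oscExp γ) = 0) :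
    (oscString γ).HasMonotonicSecondTerm (1 / 2) := by
  refine ⟨-(riemannZeta (1 / 2)).re, ne_of_gt (by linarith [riemannZeta_half_re_le]), ?_⟩
  refine (isLittleO_oscSpectral γ hγ).congr' ?_ EventuallyEq.rfl
  filter_upwards [eventually_gt_atTop 0] with x hx
  rw [spectralCounting_oscString γ hx, FractalString.weylTerm, oscString,
    volume_real_stringOfLengths]

/-- The substitution `y = (2ε)⁻¹` isolates the bounded factor `√y · oscTube γ y`; the exponent `d -
1/2` then decides between finite and infinite content. -/
theorem tubeQuotient_oscString (d : ℝ) {ε : ℝ} (hε : 0 < ε) :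
    (oscString γ).tubeQuotient d ε =
      ENNReal.ofReal (√2 * (√(2 * ε)⁻¹ * oscTube γ (2 * ε)⁻¹) * ε ^ (d - 1 / 2)) := by
  rw [FractalString.tubeQuotient, oscString, volume_innerTube_stringOfLengths _ _ hε,
    ← ENNReal.ofReal_div_of_pos (Real.rpow_pos_of_pos hε _), oscTube, inv_inv]
  congr 1
  have h1 : √2 * √(2 * ε)⁻¹ = ε ^ (-(1 / 2) : ℝ) := by
    rw [← Real.sqrt_mul (by norm_num), mul_inv, mul_inv_cancel_left₀ two_ne_zero, Real.sqrt_eq_rpow,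
      Real.inv_rpow hε.le, Real.rpow_neg hε.le]
  have h2 : ε ^ (-(1 / 2) : ℝ) * ε ^ (d - 1 / 2) = (ε ^ (1 - d))⁻¹ := by
    rw [← Real.rpow_add hε, ← Real.rpow_neg hε.le]
    congr 1
    ring
  rw [div_eq_mul_inv, ← h2, ← h1]
  ring

theorem eventually_oscTube_mem :
    ∀ᶠ ε : ℝ in 𝓝[>] 0, √(2 * ε)⁻¹ * oscTube γ (2 * ε)⁻¹ ∈ Set.Icc (1 : ℝ) 3 := by
  have htop : Tendsto (fun ε : ℝ ↦ (2 * ε)⁻¹) (𝓝[>] 0) atTop := by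
    have := Tendsto.const_mul_atTop (show (0 : ℝ) < 2⁻¹ by norm_num) (tendsto_inv_nhdsGT_zero (𝕜 := ℝ))
    simpa [mul_inv, mul_comm] using this
  have h : ∀ᶠ y : ℝ in atTop, √y * oscTube γ y ∈ Set.Icc (1 : ℝ) 3 := by
    -- For `√y ≥ 34` the error `17/√y` is at most `1/2`, and the wave lies within `1/2` of `2`.
    filter_upwards [eventually_ge_atTop 16, Real.tendsto_sqrt_atTop.eventually_ge_atTop 34]
      with y hy hy'
    have hy0 : 0 < y := by linarith
    have h1 := abs_oscTube_sub_le γ hy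
    have h2 := abs_oscWave_sub_two_le γ hy0
    have h3 : 17 / √y ≤ 1 / 2 := by
      rw [div_le_div_iff₀ (by linarith) two_pos]
      linarith
    rw [abs_le] at h1 h2
    constructor <;> linarith [h1.1, h1.2, h2.1, h2.2]
  exact htop.eventually h

theorem upperContent_oscString_lt_top {d : ℝ} (hd : 1 / 2 ≤ d) :
    (oscString γ).upperContent d < ∞ := by
  refine lt_of_le_of_lt (limsup_le_of_le (a := ENNReal.ofReal (√2 * 3 * 1)) (by isBoundedDefault) ?_)
    ENNReal.ofReal_lt_top
  filter_upwards [eventually_oscTube_mem γ, self_mem_nhdsWithin,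
    nhdsWithin_le_nhds (eventually_le_nhds zero_lt_one)] with ε h hε hε1
  rw [tubeQuotient_oscString γ d hε]
  have h1 : ε ^ (d - 1 / 2) ≤ 1 := Real.rpow_le_one (le_of_lt hε) hε1 (by linarith)
  have h0 : 0 ≤ ε ^ (d - 1 / 2) := Real.rpow_nonneg (le_of_lt hε) _
  gcongr
  exact h.2

theorem upperContent_oscString_eq_top {d : ℝ} (hd : d < 1 / 2) :
    (oscString γ).upperContent d = ∞ := by
  have h1 : Tendsto (fun ε : ℝ ↦ ε ^ (d - 1 / 2)) (𝓝[>] 0) atTop :=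
    tendsto_rpow_neg_nhdsGT_zero (by linarith)
  refine Tendsto.limsup_eq (tendsto_of_tendsto_of_tendsto_of_le_of_le'
    (ENNReal.tendsto_ofReal_atTop.comp h1) tendsto_const_nhds ?_ (Eventually.of_forall fun _ ↦ le_top))
  filter_upwards [eventually_oscTube_mem γ, self_mem_nhdsWithin] with ε h hε
  rw [tubeQuotient_oscString γ d hε, Function.comp_apply]
  apply ENNReal.ofReal_le_ofReal
  have h0 : 0 ≤ ε ^ (d - 1 / 2) := Real.rpow_nonneg (le_of_lt hε) _
  have h2 : 1 ≤ √2 := Real.one_le_sqrt.2 (by norm_num)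
  have h3 : 1 ≤ √2 * (√(2 * ε)⁻¹ * oscTube γ (2 * ε)⁻¹) := by nlinarith [h.1]
  exact le_mul_of_one_le_left h0 h3

theorem minkowskiDim_oscString : (oscString γ).minkowskiDim = 1 / 2 := by
  have : {d : ℝ | 0 ≤ d ∧ (oscString γ).upperContent d < ∞} = Set.Ici (1 / 2) := by
    ext d
    simp only [Set.mem_ofPred_eq, Set.mem_Ici]
    constructor
    · rintro ⟨_, h⟩
      by_contra! hd
      exact h.ne (upperContent_oscString_eq_top γ hd)
    · intro hd
      exact ⟨by linarith, upperContent_oscString_lt_top γ hd⟩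
  rw [FractalString.minkowskiDim, this, csInf_Ici]

/-- Equal finite contents would give the tube quotient a limit, and hence `√y · oscTube γ y` as
well. -/
theorem not_isMinkowskiMeasurable_oscString (hγ : γ ≠ 0) :
    ¬ (oscString γ).IsMinkowskiMeasurable := by
  rintro ⟨-, h1, h2⟩
  rw [minkowskiDim_oscString] at h1 h2
  have ht : Tendsto (fun ε ↦ (oscString γ).tubeQuotient (1 / 2) ε) (𝓝[>] 0)
      (𝓝 ((oscString γ).upperContent (1 / 2))) := tendsto_of_liminf_eq_limsup h1 rfl
  have ht' := (ENNReal.tendsto_toReal h2.ne).comp ht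
  have hy : Tendsto (fun y : ℝ ↦ (2 * y)⁻¹) atTop (𝓝[>] 0) :=
    tendsto_inv_atTop_nhdsGT_zero.comp (tendsto_id.const_mul_atTop two_pos)
  refine not_tendsto_oscTube γ hγ
    ((√2)⁻¹ * ((oscString γ).upperContent (1 / 2)).toReal) ?_
  refine ((ht'.comp hy).const_mul (√2)⁻¹).congr' ?_
  filter_upwards [eventually_gt_atTop 0] with y hy0
  have h0 : 0 ≤ oscTube γ y :=
    tsum_nonneg fun n ↦ le_min (inv_pos.2 hy0).le (oscLength_pos γ n).le
  have e : (2 * (2 * y)⁻¹)⁻¹ = y := by field_simp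
  simp only [Function.comp_apply]
  rw [tubeQuotient_oscString γ _ (by positivity), e, sub_self, Real.rpow_zero, mul_one,
    ENNReal.toReal_ofReal (by positivity), inv_mul_cancel_left₀ (by positivity)]

end Osc

theorem corollary6p3 : ¬ InverseSpectralProblem (1 / 2) := by
  obtain ⟨γ, hγ, hzero⟩ := exists_zero_on_critical_line
  exact fun h ↦ not_isMinkowskiMeasurable_oscString γ hγ
    (h (oscString γ) (minkowskiDim_oscString γ) (hasMonotonicSecondTerm_oscString γ hzero))
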